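/- Let $G$ be a finite two-player extensive-form game with perfect recall (general-sum, not necessarily of perfect information) in which there are no nature nodes, every internal node has exactly $b\ge 2$ children, moves alternate (the player who acts at a node does not act at its children), every leaf has depth $d\ge 1$, and all payoffs satisfy $|u_i(z)|\le M$. Let $N=b^d$ be the number of terminal nodes. The sequence of player $i$ at a node $h$ is the list of information sets of player $i$ met, and actions taken there, on the path from the root to $h$; a terminal sequence is the sequence of a player at a terminal node. Let $D$ be the maximum, over both players and all pure strategies of that player, of the number of that player's terminal sequences in the support of the pure strategy. A trunk of $G$ is obtained by collapsing some internal nodes of $G$ into leaves (removing them from their information sets) and giving, for each player $i$, lower and upper bounds $\alpha_i(h)\le\beta_i(h)$ at each leaf $h$ of the trunk, such that $\alpha_i(h)\le u_i(z)\le\beta_i(h)$ for every terminal node $z$ of $G$ that equals or descends from $h$. An $\varepsilon$-certificate for $G$ is a pair $(\tilde G,\sigma)$ of a trunk $\tilde G$ and a profile $\sigma$ of behavior strategies in $\tilde G$ such that, for each player $i$, $\max_{\sigma_i'}\beta_i(\sigma_i',\sigma_{-i})-\alpha_i(\sigma)\le\varepsilon$, where $\alpha_i(\cdot),\beta_i(\cdot)$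 denote expected values over the leaf of $\tilde G$ that is reached. Its size is the number of nodes of $\tilde G$. Then $G$ has an $\varepsilon$-certificate of size $O\!\left(\sqrt N\,(D^2/\varepsilon^2)\log N\right)$. Precisely: for all $b\ge 2$, $M$ and $\varepsilon_0$ there is a constant $C>0$, depending only on $b$, $M$ and $\varepsilon_0$, such that every such game $G$ (with any $d\ge1$) and every $\varepsilon\in(0,\varepsilon_0]$ admit an $\varepsilon$-certificate with at most $C\sqrt N\,(D^2/\varepsilon^2)\log N$ nodes. -/

import Mathlib

namespace ExtensiveForm

noncomputable section

open scoped Classical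

theorem cons_injOn {A : Type*} (h : List A) (S : Set A) :
    Set.InjOn (fun a => a :: h) S := fun _ _ _ _ e => (List.cons.inj e).1

/-- The tree and information structure of a finite extensive-form game with players `ι`,
action labels `A` and information-set labels `J`.  A history is the list of the actions taken
so far, *most recent action first*: the root is `[]`, and the child of `h` along the edge
labelled `a` is `a :: h`.  The values of `player`, `info`, `chance` matter at non-leaf nodes only.
The information sets of player `i` are the fibres of `info` on the decision nodes of player `i`. -/
structure GameTree (ι A J : Type*) where
  /-- the finite set of histories -/
  nodes : Finset (List A)
  root_mem : [] ∈ nodes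
  parent_mem : ∀ (a : A) (h : List A), a :: h ∈ nodes → h ∈ nodes
  /-- the player who acts at a node; `none` is nature -/
  player : List A → Option ι
  /-- the label of the information set of a node -/
  info : List A → J
  /-- nature's distribution at a node -/
  chance : List A → A → ℝ
  /-- nodes of the same information set have the same actions -/
  same_actions : ∀ (i : ι) (h h' : List A),
    (∃ a, a :: h ∈ nodes) → (∃ a, a :: h' ∈ nodes) →
    player h = some i → player h' = some i → info h = info h' →
    ∀ a, a :: h ∈ nodes ↔ a :: h' ∈ nodes
  chance_nonneg : ∀ h a, player h = none → a :: h ∈ nodes → 0 ≤ chance h a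
  chance_sum : ∀ h, (∃ a, a :: h ∈ nodes) → player h = none →
    ∑ a ∈ nodes.preimage (fun a => a :: h) (cons_injOn h _), chance h a = 1

namespace GameTree

variable {ι A J : Type*} (G : GameTree ι A J)

/-- The actions available at `h`. -/
def actions (h : List A) : Finset A :=
  G.nodes.preimage (fun a => a :: h) (cons_injOn h _)

/-- `h` is an internal (non-leaf) node. -/
def Internal (h : List A) : Prop := ∃ a, a :: h ∈ G.nodes

/-- The leaves (terminal nodes). -/
def leaves : Finset (List A) := G.nodes.filter fun h => ¬ G.Internal h

/-- `h` is a decision node of player `i`. -/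
def Decision (i : ι) (h : List A) : Prop := G.Internal h ∧ G.player h = some i

/-- The sequence of player `i` at `h`: the information sets of player `i` met on the path from the
root to `h`, with the actions taken there (most recent first). -/
def seq (i : ι) : List A → List (J × A)
  | [] => []
  | a :: h => if G.player h = some i then (G.info h, a) :: seq i h else seq i h

/-- Perfect recall: a player has the same sequence at any two nodes of an information set. -/
def PerfectRecall : Prop :=
  ∀ (i : ι) (h h' : List A), G.Decision i h → G.Decision i h' → G.info h = G.info h' →
    G.seq i h = G.seq i h'

/-- `s` is a behavior strategy of player `i`: at each information set of player `i`,
`s j` is a probability distribution over the actions available there. -/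
def IsStrategy (i : ι) (s : J → A → ℝ) : Prop :=
  ∀ h, G.Decision i h →
    (∀ a ∈ G.actions h, 0 ≤ s (G.info h) a) ∧ ∑ a ∈ G.actions h, s (G.info h) a = 1

/-- A pure strategy: a behavior strategy that chooses one action at each information set. -/
def IsPureStrategy (i : ι) (s : J → A → ℝ) : Prop :=
  G.IsStrategy i s ∧
    ∀ h, G.Decision i h → ∀ a ∈ G.actions h, s (G.info h) a = 0 ∨ s (G.info h) a = 1

/-- A strategy profile: a behavior strategy for each player. -/
def IsProfile (σ : ι → J → A → ℝ) : Prop := ∀ i, G.IsStrategy i (σ i)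

/-- The reach probability `σ_i(h)`: player `i` plays `s`, everybody else plays towards `h`. -/
def reach (i : ι) (s : J → A → ℝ) : List A → ℝ
  | [] => 1
  | a :: h => reach i s h * if G.player h = some i then s (G.info h) a else 1

/-- Nature's reach probability `σ_0(h)`. -/
def natureReach : List A → ℝ
  | [] => 1
  | a :: h => natureReach h * if G.player h = none then G.chance h a else 1

/-- The expectation of `f` over the leaf reached under the profile `σ`. -/
def value [Fintype ι] (f : List A → ℝ) (σ : ι → J → A → ℝ) : ℝ :=
  ∑ z ∈ G.leaves, (G.natureReach z * ∏ i, G.reach i (σ i) z) * f z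

/-- The terminal sequences in the support of the strategy `s` of player `i`. -/
def terminalSeqs (i : ι) (s : J → A → ℝ) : Finset (List (J × A)) :=
  (G.leaves.filter fun z => 0 < G.reach i s z).image (G.seq i)

/-- The maximum number of terminal sequences in the support of a pure strategy of any player
(the maximum exists: the numbers are at most the number of leaves). -/
def maxTerminalSeqs : ℕ :=
  sSup {n | ∃ i s, G.IsPureStrategy i s ∧ n = (G.terminalSeqs i s).card}

theorem bddAbove_terminalSeqs :
    BddAbove {n | ∃ i s, G.IsPureStrategy i s ∧ n = (G.terminalSeqs i s).card} := by
  refine ⟨G.leaves.card, ?_⟩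
  rintro n ⟨i, s, -, rfl⟩
  exact Finset.card_image_le.trans (Finset.card_filter_le _ _)

/-- There are no nature nodes. -/
def NoNature : Prop := ∀ h, G.Internal h → G.player h ≠ none

/-- Every internal node has exactly `b` children. -/
def UniformBranching (b : ℕ) : Prop := ∀ h, G.Internal h → (G.actions h).card = b

/-- The player who acts at an internal node never acts at an internal child of it. -/
def Alternating : Prop :=
  ∀ a h, G.Internal (a :: h) → G.player (a :: h) ≠ G.player h

/-- Every leaf has depth `d`. -/
def UniformDepth (d : ℕ) : Prop := ∀ z ∈ G.leaves, z.length = d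

end GameTree

/-- A game: a game tree with a utility for each player at each leaf. -/
structure Game (ι A J : Type*) extends GameTree ι A J where
  util : ι → List A → ℝ

/-- A pseudogame: at each leaf, each player only has a lower and an upper bound on the utility. -/
structure Pseudogame (ι A J : Type*) extends GameTree ι A J where
  lower : ι → List A → ℝ
  upper : ι → List A → ℝ
  lower_le_upper : ∀ i, ∀ z ∈ toGameTree.leaves, lower i z ≤ upper i z

/-- The profile `σ` is an `ε`-Nash equilibrium of the pseudogame `T`: no player can get
optimistically, by deviating, more than `ε` above what `σ` gives pessimistically. -/
def Pseudogame.IsEpsNash {ι A J : Type*} [Fintype ι] (T : Pseudogame ι A J) (ε : ℝ)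
    (σ : ι → J → A → ℝ) : Prop :=
  T.IsProfile σ ∧ ∀ (i : ι) (s : J → A → ℝ), T.IsStrategy i s →
    T.value (T.upper i) (Function.update σ i s) - T.value (T.lower i) σ ≤ ε

/-- `T` is a trunk of `G`: it arises by collapsing some internal nodes of `G` into leaves (an
internal node of `T` keeps all its children, its player, its information set and its chance
distribution), and the bounds at each leaf `h` of `T` are correct for all leaves `z` of `G` at or
below `h` (histories being listed most recent action first, `z` is at or below `h` iff the list
`h` is a suffix of `z`). -/
structure IsTrunk {ι A J : Type*} (T : Pseudogame ι A J) (G : Game ι A J) : Prop where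
  nodes_subset : T.nodes ⊆ G.nodes
  children : ∀ h, T.Internal h → ∀ a, a :: h ∈ G.nodes → a :: h ∈ T.nodes
  player_eq : ∀ h, T.Internal h → T.player h = G.player h
  info_eq : ∀ h, T.Internal h → T.info h = G.info h
  chance_eq : ∀ h, T.Internal h → G.player h = none →
    ∀ a ∈ T.actions h, T.chance h a = G.chance h a
  bounds : ∀ h ∈ T.leaves, ∀ z ∈ G.leaves, h <:+ z →
    ∀ i, T.lower i h ≤ G.util i z ∧ G.util i z ≤ T.upper i h

/-- `(T, σ)` is an `ε`-certificate for `G`. -/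
def IsCertificate {ι A J : Type*} [Fintype ι] (G : Game ι A J) (ε : ℝ) (T : Pseudogame ι A J)
    (σ : ι → J → A → ℝ) : Prop :=
  IsTrunk T G ∧ T.IsEpsNash ε σ

end

end ExtensiveForm

/-!
The certificate is built from pure strategies sampled from an equilibrium.

Take an approximate Nash equilibrium in mixed strategies and draw `k` pure strategies of each
player from it.  The mixture of the draws of a player is realized by a behavior strategy (Kuhn's
theorem, `GameTree.PerfectRecall.exists_strategy_reach_eq`), and the trunk keeps as internal nodes
the internal nodes of `G` in the reach of some drawn strategy.  If one player deviates, the other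
one still plays inside the trunk, so only leaves of `G` are reached (`value_trunk`), and the trivial
bounds at the collapsed nodes play no role.  As the moves alternate, a pure strategy has of the
order of `√N` internal nodes in its reach (`GameTree.card_reached_internal_le`), so the trunk has
`O(k √N)` nodes.

It remains to see that `k = O((D² / ε²) log N)` draws suffice.  Without nature, a pure strategy of
one player and a sequence of the other determine the leaf (`GameTree.leaf_eq_of_seq_eq`), so that
the payoff contributed by a terminal sequence `q` of player `i` against a drawn strategy of
player `j` is bounded (`GameTree.abs_seqPay_le`).  By Hoeffding's lemma and a union bound over the
at most `N` terminal sequences, all these contributions are simultaneously within `ε / (4 D)` of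
their means (`exists_samples_abs_sub_le`; the draws are chosen greedily with an exponential
potential instead of at random).  The payoff of a pure strategy is a sum of at most `D`
contributions, so it changes by at most `ε / 4` (`GameTree.abs_sum_pay_sub_le`).  Deviations to
behavior strategies reduce to pure ones because reach probabilities are affine in the distribution
at each information set (`GameTree.PerfectRecall.exists_pure_le`).

The existence of an approximate equilibrium (`exists_approx_nash_bimatrix`) is derived from Scarf's
combinatorial lemma (`exists_dominated_rainbow`), a relative of Sperner's lemma: grid points
of the simplex spanned by the pure strategies of both players are coloured by best responses, and
close grid points of all the colours that occur in their carrier give an equilibrium.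
-/

/-! ### Scarf's lemma -/

section Scarf

open scoped Classical
open Finset

/-- Given a family `k` of rankings of `X`, the set `R` is dominated if no `y` is ranked strictly
above the lowest element of `R` by all the rankings at once. -/
def Dominated {X I : Type*} (k : I → X → ℕ) (R : Finset X) : Prop :=
  ∀ y, ∃ i, ∀ x ∈ R, k i y ≤ k i x

theorem Dominated.mono {X I : Type*} {k : I → X → ℕ} {R S : Finset X} (h : Dominated k R)
    (hS : S ⊆ R) : Dominated k S := fun y => by
  obtain ⟨i, hi⟩ := h y
  exact ⟨i, fun x hx => hi x (hS hx)⟩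

/-- A dominated set `τ` with one element fewer than there are rankings has exactly two dominated
extensions by one element.  Exactly one element of `τ` is the lowest one in two rankings `a` and
`b`; the new element takes over this role in one of these, and it has to be the highest one, in
that ranking, among those above the lowest elements of `τ` in all the others. -/
theorem card_dominated_extensions {X I : Type*} [Fintype X] [Fintype I] {k : I → X → ℕ}
    (hk : ∀ i, Function.Injective (k i)) {τ : Finset X}
    (hne : τ.Nonempty) (hτ : Dominated k τ) (hcard : τ.card + 1 = Fintype.card I)
    (hM : ∀ j, ∃ y, ∀ i, i ≠ j → ∃ x ∈ τ, k i x < k i y) :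
    (univ.filter fun x => x ∉ τ ∧ Dominated k (insert x τ)).card = 2 := by
  have hmin : ∀ i, ∃ x ∈ τ, ∀ y ∈ τ, k i x ≤ k i y := fun i => exists_min_image τ (k i) hne
  choose μ hμ hμmin using hmin
  have hsurj : ∀ x ∈ τ, ∃ i, μ i = x := by
    intro x hx
    obtain ⟨i, hi⟩ := hτ x
    exact ⟨i, hk i (le_antisymm (hμmin i x hx) (hi _ (hμ i)))⟩
  obtain ⟨a, -, b, -, hab, hμab⟩ : ∃ a ∈ (univ : Finset I), ∃ b ∈ (univ : Finset I),
      a ≠ b ∧ μ a = μ b :=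
    exists_ne_map_eq_of_card_lt_of_maps_to (t := τ) (by rw [card_univ]; omega)
      (fun i _ => hμ i)
  -- an index whose removal keeps all lowest elements is `a` or `b`
  have hpair : ∀ j, (∀ z ∈ τ, ∃ i, i ≠ j ∧ μ i = z) → j = a ∨ j = b := by
    intro j hj
    by_contra! hcon
    have hinj : Set.InjOn μ (univ.erase j : Finset I) :=
      injOn_of_surjOn_of_card_le μ (t := τ) (fun i _ => hμ i)
        (fun z hz => by
          obtain ⟨i, hi, rfl⟩ := hj z hz
          exact ⟨i, by simpa using hi, rfl⟩)
        (by rw [card_erase_of_mem (mem_univ j), card_univ]; omega)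
    exact hab (hinj (by simpa using hcon.1.symm) (by simpa using hcon.2.symm) hμab)
  have htop : ∀ j, ∃ x, (∀ i, i ≠ j → k i (μ i) < k i x) ∧
      ∀ y, (∀ i, i ≠ j → k i (μ i) < k i y) → k j y ≤ k j x := by
    intro j
    obtain ⟨x, hx, hmax⟩ := exists_max_image
      (univ.filter fun y => ∀ i, i ≠ j → k i (μ i) < k i y) (k j) (by
        obtain ⟨y, hy⟩ := hM j
        refine ⟨y, mem_filter.2 ⟨mem_univ _, fun i hi => ?_⟩⟩
        obtain ⟨x, hx, hxy⟩ := hy i hi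
        exact (hμmin i x hx).trans_lt hxy)
    exact ⟨x, (mem_filter.1 hx).2, fun y hy => hmax y (mem_filter.2 ⟨mem_univ _, hy⟩)⟩
  choose ξ hξ hξmax using htop
  have hlow : ∀ j, k j (ξ j) ≤ k j (μ j) := by
    intro j
    obtain ⟨i, hi⟩ := hτ (ξ j)
    rcases eq_or_ne i j with rfl | hij
    · exact hi _ (hμ i)
    · exact absurd (hi _ (hμ i)) (not_le.2 (hξ j i hij))
  have hdom : ∀ j, Dominated k (insert (ξ j) τ) := by
    intro j y
    by_cases hy : ∀ i, i ≠ j → k i (μ i) < k i y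
    · obtain ⟨i, hi⟩ := hτ y
      rcases eq_or_ne i j with rfl | hij
      · refine ⟨i, fun x hx => ?_⟩
        rcases mem_insert.1 hx with rfl | hx
        · exact hξmax i y hy
        · exact hi x hx
      · exact absurd (hi _ (hμ i)) (not_le.2 (hy i hij))
    · push Not at hy
      obtain ⟨i, hij, hi⟩ := hy
      refine ⟨i, fun x hx => ?_⟩
      rcases mem_insert.1 hx with rfl | hx
      · exact hi.trans (hξ j i hij).le
      · exact hi.trans (hμmin i x hx)
  have hnot : ∀ j j', j ≠ j' → μ j = μ j' → ξ j ∉ τ := by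
    intro j j' hjj hμj hmem
    have h1 : ξ j = μ j := hk j (le_antisymm (hlow j) (hμmin j _ hmem))
    have h2 := hξ j j' hjj.symm
    rw [h1, hμj] at h2
    exact lt_irrefl _ h2
  have hne' : ξ a ≠ ξ b := by
    intro h
    have h1 := hξ a b hab.symm
    rw [h] at h1
    exact absurd (hlow b) (not_le.2 h1)
  -- in a dominated extension, the new element `x` is the lowest one in exactly one ranking `j`
  have key : (univ.filter fun x => x ∉ τ ∧ Dominated k (insert x τ)) = {ξ a, ξ b} := by
    ext x
    simp only [mem_filter, mem_univ, true_and, mem_insert, mem_singleton]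
    constructor
    · rintro ⟨hx, hd⟩
      obtain ⟨j, hj⟩ := hd x
      have hcov : ∀ z ∈ τ, ∃ i, μ i = z ∧ k i (μ i) < k i x := by
        intro z hz
        obtain ⟨i, hi⟩ := hd z
        have h1 : μ i = z :=
          hk i (le_antisymm (hμmin i z hz) (hi _ (mem_insert_of_mem (hμ i))))
        refine ⟨i, h1, ?_⟩
        rw [h1]
        refine lt_of_le_of_ne (hi x (mem_insert_self _ _)) fun h => hx ?_
        rw [← hk i h]; exact hz
      have hjx : k j x ≤ k j (μ j) := hj _ (mem_insert_of_mem (hμ j))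
      have hJ : (univ.filter fun i => k i (μ i) < k i x) = univ.erase j := by
        refine eq_of_subset_of_card_le (fun i hi => ?_) ?_
        · rw [mem_filter] at hi
          refine mem_erase.2 ⟨?_, mem_univ _⟩
          rintro rfl
          exact absurd hjx (not_le.2 hi.2)
        · rw [card_erase_of_mem (mem_univ j), card_univ, ← hcard, Nat.add_sub_cancel]
          refine card_le_card_of_surjOn μ fun z hz => ?_
          obtain ⟨i, hi, hlt⟩ := hcov z hz
          exact ⟨i, by simpa using hlt, hi⟩
      have hxM : ∀ i, i ≠ j → k i (μ i) < k i x := by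
        intro i hi
        have : i ∈ univ.filter fun i => k i (μ i) < k i x := by
          rw [hJ]; exact mem_erase.2 ⟨hi, mem_univ _⟩
        exact (mem_filter.1 this).2
      have hxj : x = ξ j := by
        refine hk j (le_antisymm (hξmax j x hxM) ?_)
        obtain ⟨i, hi⟩ := hd (ξ j)
        rcases eq_or_ne i j with rfl | hij
        · exact hi _ (mem_insert_self _ _)
        · exact absurd (hi _ (mem_insert_of_mem (hμ i))) (not_le.2 (hξ j i hij))
      have := hpair j fun z hz => by
        obtain ⟨i, hi, hlt⟩ := hcov z hz
        refine ⟨i, ?_, hi⟩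
        rintro rfl
        exact absurd hjx (not_le.2 hlt)
      rcases this with rfl | rfl
      · exact Or.inl hxj
      · exact Or.inr hxj
    · rintro (rfl | rfl)
      · exact ⟨hnot a b hab hμab, hdom a⟩
      · exact ⟨hnot b a hab.symm hμab.symm, hdom b⟩
  rw [key, card_pair hne']

/-- Among the facets of a set with as many elements as there are colours, the number of those that
carry all the colours but `i₀` is even unless the set carries all the colours. -/
theorem image_eq_univ_of_odd_facets {X I : Type*} [Fintype I] (c : X → I) (i₀ : I) {R : Finset X}
    (hR : R.card = Fintype.card I)
    (hodd : Odd (R.filter fun x => (R.erase x).image c = univ.erase i₀).card) :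
    R.image c = univ := by
  by_contra hc
  obtain ⟨x, hx⟩ := card_pos.1 hodd.pos
  obtain ⟨hxR, hx⟩ := mem_filter.1 hx
  have hcx : c x ≠ i₀ := by
    intro h
    apply hc
    rw [← insert_erase hxR, image_insert, hx, h, insert_erase (mem_univ _)]
  have hinj : Set.InjOn c (R.erase x : Finset X) := by
    rw [← card_image_iff, hx, card_erase_of_mem (mem_univ _), card_univ,
      card_erase_of_mem hxR, hR]
  obtain ⟨x', hx', hcx'⟩ : ∃ x' ∈ R.erase x, c x' = c x := by
    rw [← mem_image, hx]
    exact mem_erase.2 ⟨hcx, mem_univ _⟩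
  obtain ⟨hxx, hxR'⟩ := mem_erase.1 hx'
  have hkey : (R.filter fun x => (R.erase x).image c = univ.erase i₀) = {x, x'} := by
    ext y
    simp only [mem_filter, mem_insert, mem_singleton]
    constructor
    · rintro ⟨hyR, hy⟩
      by_contra! hcon
      have hyx : y ∈ R.erase x := mem_erase.2 ⟨hcon.1, hyR⟩
      have hcy : c y ∈ (R.erase y).image c := by
        rw [hy, ← hx]; exact mem_image_of_mem _ hyx
      obtain ⟨y', hy', hcy'⟩ := mem_image.1 hcy
      obtain ⟨hyy, hyR'⟩ := mem_erase.1 hy'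
      rcases eq_or_ne y' x with rfl | hne
      · exact hcon.2 (hinj hyx hx' (hcy'.symm.trans hcx'.symm))
      · exact hyy (hinj (mem_coe.2 (mem_erase.2 ⟨hne, hyR'⟩)) hyx hcy')
    · rintro (rfl | rfl)
      · exact ⟨hxR, hx⟩
      · refine ⟨hxR', ?_⟩
        rw [← hx]
        have h1 : R.erase y = insert x ((R.erase y).erase x) :=
          (insert_erase (mem_erase.2 ⟨hxx.symm, hxR⟩)).symm
        have h2 : R.erase x = insert y ((R.erase y).erase x) := by
          rw [erase_right_comm, insert_erase hx']
        rw [h1, h2, image_insert, image_insert, hcx']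
  rw [hkey, card_pair hxx.symm] at hodd
  exact absurd hodd (by decide)

/-- **Scarf's lemma.**  The rankings have a common structure of "slack" elements `s i`, the lowest
one for the ranking `i` and higher than all ordinary elements for the other rankings.  If the slack
element `s i` has colour `i`, then some dominated set carries every colour exactly once.  This
follows by double counting the pairs of a dominated set with `card I` elements and a facet that
carries all the colours but `i₀`: every facet lies in two such sets, except
`{s i | i ≠ i₀}`, which lies in one. -/
theorem exists_dominated_rainbow {X I : Type*} [Fintype X] [Fintype I] {k : I → X → ℕ}
    (hk : ∀ i, Function.Injective (k i)) (s : I → X)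
    (hs : ∀ i y, k i (s i) ≤ k i y)
    (hs' : ∀ x, x ∉ Set.range s → ∀ i j, i ≠ j → k i x < k i (s j))
    (hX : ∃ x, x ∉ Set.range s) (c : X → I) (hc : ∀ i, c (s i) = i) [Nonempty I] :
    ∃ R : Finset X, R.card = Fintype.card I ∧ Dominated k R ∧ R.image c = univ := by
  obtain ⟨i₀⟩ := ‹Nonempty I›
  have hsinj : Function.Injective s := fun i j h => by rw [← hc i, h, hc]
  let D : Finset (Finset X) := univ.filter fun τ =>
    τ.card + 1 = Fintype.card I ∧ Dominated k τ ∧ τ.image c = univ.erase i₀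
  let P : Finset (Finset X) := univ.filter fun R => R.card = Fintype.card I ∧ Dominated k R
  have hIpos : 0 < Fintype.card I := Fintype.card_pos_iff.2 ⟨i₀⟩
  have hroom : ∀ R ∈ P, (D.filter fun τ => τ ⊆ R).card =
      (R.filter fun x => (R.erase x).image c = univ.erase i₀).card := by
    intro R hR
    obtain ⟨hRc, hRd⟩ := (mem_filter.1 hR).2
    symm
    refine card_bij (fun x _ => R.erase x) ?_ ?_ ?_
    · intro x hx
      obtain ⟨hxR, hx⟩ := mem_filter.1 hx
      refine mem_filter.2 ⟨mem_filter.2 ⟨mem_univ _, ?_, hRd.mono (erase_subset _ _), hx⟩,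
        erase_subset _ _⟩
      rw [card_erase_of_mem hxR]; omega
    · intro x hx y _ hxy
      by_contra hne
      have : x ∈ R.erase y := mem_erase.2 ⟨hne, (mem_filter.1 hx).1⟩
      rw [← hxy] at this
      exact absurd this (notMem_erase _ _)
    · intro τ hτ
      obtain ⟨hτD, hτR⟩ := mem_filter.1 hτ
      obtain ⟨hτc, -, hτi⟩ := (mem_filter.1 hτD).2
      obtain ⟨x, hx⟩ : ∃ x, R \ τ = {x} := by
        rw [← card_eq_one, card_sdiff_of_subset hτR]; omega
      have hxm : x ∈ R \ τ := by rw [hx]; exact mem_singleton_self _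
      have he : R.erase x = τ := by
        rw [← sdiff_singleton_eq_erase, ← hx, Finset.sdiff_sdiff_eq_self hτR]
      exact ⟨x, mem_filter.2 ⟨(mem_sdiff.1 hxm).1, by rw [he]; exact hτi⟩, he⟩
  have hdoor : ∀ τ ∈ D, (P.filter fun R => τ ⊆ R).card =
      (univ.filter fun x => x ∉ τ ∧ Dominated k (insert x τ)).card := by
    intro τ hτ
    obtain ⟨hτc, -, -⟩ := (mem_filter.1 hτ).2
    symm
    refine card_bij (fun x _ => insert x τ) ?_ ?_ ?_
    · intro x hx
      obtain ⟨hxτ, hd⟩ := (mem_filter.1 hx).2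
      refine mem_filter.2 ⟨mem_filter.2 ⟨mem_univ _, ?_, hd⟩, subset_insert _ _⟩
      rw [card_insert_of_notMem hxτ, hτc]
    · intro x hx y _ hxy
      have : x ∈ insert y τ := by
        have h : insert x τ = insert y τ := hxy
        rw [← h]; exact mem_insert_self _ _
      exact (mem_insert.1 this).resolve_right (mem_filter.1 hx).2.1
    · intro R hR
      obtain ⟨hRP, hτR⟩ := mem_filter.1 hR
      obtain ⟨hRc, hRd⟩ := (mem_filter.1 hRP).2
      obtain ⟨x, hx⟩ : ∃ x, R \ τ = {x} := by
        rw [← card_eq_one, card_sdiff_of_subset hτR]; omega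
      have hxm : x ∈ R \ τ := by rw [hx]; exact mem_singleton_self _
      have he : insert x τ = R := by
        rw [insert_eq, ← hx, sdiff_union_of_subset hτR]
      exact ⟨x, mem_filter.2 ⟨mem_univ _, (mem_sdiff.1 hxm).2, by rw [he]; exact hRd⟩, he⟩
  let τ₀ : Finset X := (univ.erase i₀).image s
  have hτ₀D : τ₀ ∈ D := by
    refine mem_filter.2 ⟨mem_univ _, ?_, ?_, ?_⟩
    · rw [card_image_of_injective _ hsinj, card_erase_of_mem (mem_univ _), card_univ]; omega
    · intro y
      by_cases hy : y ∈ Set.range s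
      · obtain ⟨i, rfl⟩ := hy
        exact ⟨i, fun x _ => hs i x⟩
      · refine ⟨i₀, fun x hx => ?_⟩
        obtain ⟨i, hi, rfl⟩ := mem_image.1 hx
        exact (hs' y hy i₀ i (mem_erase.1 hi).1.symm).le
    · rw [image_image, show c ∘ s = id from funext hc, image_id]
  have houter : (univ.filter fun x => x ∉ τ₀ ∧ Dominated k (insert x τ₀)).card = 1 := by
    obtain ⟨m, hm, hmax⟩ := exists_max_image (univ.filter fun x => x ∉ Set.range s) (k i₀) (by
      obtain ⟨x, hx⟩ := hX
      exact ⟨x, mem_filter.2 ⟨mem_univ _, hx⟩⟩)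
    replace hm := (mem_filter.1 hm).2
    have hcol : ∀ y, y ∉ Set.range s → ∀ i, (∀ x ∈ τ₀, k i y ≤ k i x) → i = i₀ := by
      intro y hy i hi
      by_contra hne
      have := hi (s i) (mem_image_of_mem _ (mem_erase.2 ⟨hne, mem_univ _⟩))
      exact hy ⟨i, hk i (le_antisymm (hs i y) this)⟩
    rw [card_eq_one]
    refine ⟨m, ?_⟩
    ext x
    simp only [mem_filter, mem_univ, true_and, mem_singleton]
    constructor
    · rintro ⟨hx, hd⟩
      obtain ⟨i, hi⟩ := hd m
      obtain rfl := hcol m hm i fun z hz => hi z (mem_insert_of_mem hz)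
      have hmx := hi x (mem_insert_self _ _)
      refine hk i (le_antisymm (hmax x (mem_filter.2 ⟨mem_univ _, ?_⟩)) hmx)
      rintro ⟨j, rfl⟩
      have hj : j = i := by
        by_contra hne
        exact hx (mem_image_of_mem _ (mem_erase.2 ⟨hne, mem_univ _⟩))
      subst hj
      exact hm ⟨j, hk j (le_antisymm (hs j m) hmx)⟩
    · rintro rfl
      refine ⟨fun h => ?_, fun y => ?_⟩
      · obtain ⟨i, -, hi⟩ := mem_image.1 h
        exact hm ⟨i, hi⟩
      · by_cases hy : y ∈ Set.range s
        · obtain ⟨i, rfl⟩ := hy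
          exact ⟨i, fun x _ => hs i x⟩
        · refine ⟨i₀, fun z hz => ?_⟩
          rcases mem_insert.1 hz with rfl | hz
          · exact hmax y (mem_filter.2 ⟨mem_univ _, hy⟩)
          · obtain ⟨i, hi, rfl⟩ := mem_image.1 hz
            exact (hs' y hy i₀ i (mem_erase.1 hi).1.symm).le
  have hinner : ∀ τ ∈ D.erase τ₀,
      (univ.filter fun x => x ∉ τ ∧ Dominated k (insert x τ)).card = 2 := by
    intro τ hτ
    obtain ⟨hne, hτD⟩ := mem_erase.1 hτ
    obtain ⟨hτc, hτd, hτi⟩ := (mem_filter.1 hτD).2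
    obtain ⟨x, hxτ, hx⟩ : ∃ x ∈ τ, x ∉ Set.range s := by
      by_contra! hcon
      apply hne
      rw [show τ₀ = (univ.erase i₀).image s from rfl, ← hτi, image_image]
      symm
      convert image_id' using 1
      refine image_congr fun x hx => ?_
      obtain ⟨i, rfl⟩ := hcon x hx
      simp [hc]
    exact card_dominated_extensions hk ⟨x, hxτ⟩ hτd hτc
      fun j => ⟨s j, fun i hij => ⟨x, hxτ, hs' x hx i j hij⟩⟩
  have hcount := sum_card_bipartiteAbove_eq_sum_card_bipartiteBelow (s := D) (t := P)
    (fun τ R => τ ⊆ R)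
  simp only [bipartiteAbove, bipartiteBelow] at hcount
  rw [sum_congr rfl hdoor, sum_congr rfl hroom, ← add_sum_erase D _ hτ₀D, houter,
    sum_congr rfl hinner] at hcount
  by_contra! hcon
  have heven : Even (∑ R ∈ P, (R.filter fun x => (R.erase x).image c = univ.erase i₀).card) := by
    refine even_sum _ fun R hR => ?_
    obtain ⟨hRc, hRd⟩ := (mem_filter.1 hR).2
    by_contra hodd
    exact hcon R hRc hRd (image_eq_univ_of_odd_facets c i₀ hRc (Nat.not_even_iff_odd.1 hodd))
  rw [← hcount, sum_const, smul_eq_mul] at heven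
  rw [Nat.even_add] at heven
  simp at heven

end Scarf

/-! ### Close grid points of a simplex -/

section Grid

open scoped Classical
open Finset

variable {I : Type*} [Fintype I]

/-- A Sperner-type lemma without boundary conditions: colour the grid points `v : I → ℕ` of
coordinate sum `m` by `I`.  Then for some set `C` of colours there are grid points `v i` of all
the colours `i ∈ C` that are close to each other and to the face spanned by `C`, in the sense that
they have common lower bounds `μ j`, `j ∈ C`, on their coordinates whose sum is almost `m`. -/
theorem exists_close_grid_points [Nonempty I] (m : ℕ) (c : (I → ℕ) → I) :
    ∃ (C : Finset I) (v : I → I → ℕ) (μ : I → ℕ), C.Nonempty ∧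
      (∀ i ∈ C, ∑ j, v i j = m ∧ c (v i) = i ∧ ∀ j ∈ C, μ j ≤ v i j) ∧
      m < ∑ j ∈ C, (μ j + 1) := by
  let V := ↥(piAntidiag (univ : Finset I) m)
  have hV : ∀ v : V, ∑ j, (v : I → ℕ) j = m := fun v => (mem_piAntidiag.1 v.2).1
  have hV' : ∀ f : I → ℕ, ∑ j, f j = m → f ∈ piAntidiag (univ : Finset I) m :=
    fun f hf => mem_piAntidiag.2 ⟨hf, fun i _ => mem_univ i⟩
  let N := Fintype.card (V ⊕ I)
  let e : (V ⊕ I) ≃ Fin N := Fintype.equivFin _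
  -- rank by the coordinate `i`, ties being broken by `e`
  let r : I → V ⊕ I → ℕ := fun i => Sum.elim (fun v => (v : I → ℕ) i + 1)
    (fun j => if j = i then 0 else m + 2)
  let k : I → V ⊕ I → ℕ := fun i x => r i x * N + e x
  have hkle : ∀ i x y, k i x ≤ k i y → r i x ≤ r i y := by
    intro i x y h
    by_contra! hlt
    have h1 : (r i y + 1) * N ≤ r i x * N := Nat.mul_le_mul_right _ hlt
    have h2 := (e y).2
    have h3 : r i x * N + e x ≤ r i y * N + e y := h
    rw [Nat.add_mul] at h1
    omega
  have hklt : ∀ i x y, r i x < r i y → k i x < k i y := fun i x y h =>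
    not_le.1 fun h' => absurd (hkle i y x h') (not_le.2 h)
  have hk : ∀ i, Function.Injective (k i) := by
    intro i x y h
    have hr : r i x = r i y := le_antisymm (hkle i x y h.le) (hkle i y x h.ge)
    have h' : r i x * N + e x = r i y * N + e y := h
    rw [hr] at h'
    exact e.injective (Fin.ext (Nat.add_left_cancel h'))
  have hle : ∀ (v : V) i, (v : I → ℕ) i ≤ m := fun v i =>
    (single_le_sum (fun _ _ => Nat.zero_le _) (mem_univ i)).trans (hV v).le
  obtain ⟨i₁⟩ := ‹Nonempty I›
  have hpt : Function.update (fun _ => 0) i₁ m ∈ piAntidiag (univ : Finset I) m :=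
    hV' _ (by simp [Function.update_apply])
  obtain ⟨R, hRc, hRd, hRi⟩ := @exists_dominated_rainbow (V ⊕ I) I _ _ k hk Sum.inr
    (by
      rintro i (v | j)
      · exact (hklt _ _ _ (by simp [r])).le
      · rcases eq_or_ne j i with rfl | hji
        · exact le_rfl
        · exact (hklt _ _ _ (by simp [r, hji])).le)
    (by
      rintro (v | j) hx i j' hij
      · exact hklt _ _ _ (by
          have := hle v i
          simp only [r, Sum.elim_inl, Sum.elim_inr, if_neg hij.symm]; omega)
      · exact absurd ⟨j, rfl⟩ hx)
    ⟨Sum.inl ⟨_, hpt⟩, by simp⟩ (Sum.elim (fun v => c v) id) (fun i => rfl) ⟨i₁⟩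
  let C : Finset I := univ.filter fun i => Sum.inr i ∉ R
  -- a slack element outside `R` has to be replaced by a grid point of its colour
  have hcol : ∀ i, ∃ v : V, i ∈ C → Sum.inl v ∈ R ∧ c v = i := by
    intro i
    by_cases hi : i ∈ C
    · have : i ∈ R.image (Sum.elim (fun v : V => c v) id) := by rw [hRi]; exact mem_univ i
      obtain ⟨x, hx, hxi⟩ := mem_image.1 this
      rcases x with v | j
      · exact ⟨v, fun _ => ⟨hx, hxi⟩⟩
      · have hji : j = i := hxi
        subst hji
        exact absurd hx (mem_filter.1 hi).2
    · exact ⟨⟨_, hpt⟩, fun h => absurd h hi⟩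
  choose v hv using hcol
  have hdom : ∀ y : V, ∃ i ∈ C, ∀ w : V, Sum.inl w ∈ R → (y : I → ℕ) i ≤ (w : I → ℕ) i := by
    intro y
    obtain ⟨i, hi⟩ := hRd (Sum.inl y)
    refine ⟨i, mem_filter.2 ⟨mem_univ _, fun h => ?_⟩, fun w hw => ?_⟩
    · have := hkle _ _ _ (hi _ h)
      simp [r] at this
    · have := hkle _ _ _ (hi _ hw)
      simpa [r] using this
  have hCne : C.Nonempty := by
    obtain ⟨i, hi, -⟩ := hdom ⟨_, hpt⟩
    exact ⟨i, hi⟩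
  let σ : Finset V := univ.filter fun w => Sum.inl w ∈ R
  have hσ : σ.Nonempty := by
    obtain ⟨i, hi⟩ := hCne
    exact ⟨v i, mem_filter.2 ⟨mem_univ _, (hv i hi).1⟩⟩
  have hmin : ∀ i, ∃ w ∈ σ, ∀ w' ∈ σ, (w : I → ℕ) i ≤ (w' : I → ℕ) i := fun i =>
    exists_min_image σ (fun w => (w : I → ℕ) i) hσ
  choose w hw hwmin using hmin
  refine ⟨C, fun i => v i, fun j => (w j : I → ℕ) j, hCne, fun i hi => ⟨hV _, (hv i hi).2,
    fun j _ => hwmin j _ (mem_filter.2 ⟨mem_univ _, (hv i hi).1⟩)⟩, ?_⟩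
  by_contra! hcon
  -- otherwise some grid point has larger coordinates in all of `C`
  obtain ⟨i₀, hi₀⟩ := hCne
  let y : I → ℕ := fun j => (if j ∈ C then (w j : I → ℕ) j + 1 else 0) +
    if j = i₀ then m - ∑ j ∈ C, ((w j : I → ℕ) j + 1) else 0
  have hy : ∑ j, y j = m := by
    simp only [y, sum_add_distrib, sum_ite_mem, univ_inter, sum_ite_eq', mem_univ, if_true]
    rw [sum_add_distrib] at hcon
    omega
  obtain ⟨i, hi, hdi⟩ := hdom ⟨y, hV' y hy⟩
  have h1 := hdi (w i) (mem_filter.1 (hw i)).2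
  simp only [y, if_pos hi] at h1
  omega

end Grid

/-! ### Approximate equilibria of bimatrix games -/

section Nash

open scoped Classical
open Finset

/-- If `p` is carried, up to a mass `η`, by near-best responses to `q`, then it is itself a
near-best response (for masses `p`, `q` that are not normalized). -/
theorem mass_mul_le_of_near_best_response {S T : Type*} [Fintype S] [Fintype T]
    {a : S → T → ℝ} {K : ℝ} (hK : ∀ s t, |a s t| ≤ K)
    {p : S → ℝ} {q : T → ℝ} (hp : ∀ s, 0 ≤ p s) (hq : ∀ t, 0 ≤ q t) {C : Finset S} {η ζ : ℝ}
    (hη : ∑ s ∈ Cᶜ, p s ≤ η) (hK0 : 0 ≤ K) (hζ : 0 ≤ ζ)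
    (hC : ∀ s ∈ C, ∀ s', ∑ t, a s' t * q t ≤ ∑ t, a s t * q t + ζ) (s' : S) :
    (∑ s, p s) * ∑ t, a s' t * q t ≤
      ∑ s, p s * ∑ t, a s t * q t + ((∑ s, p s) * ζ + η * (2 * K * ∑ t, q t)) := by
  have hb : ∀ s, |∑ t, a s t * q t| ≤ K * ∑ t, q t := by
    intro s
    rw [mul_sum]
    refine (abs_sum_le_sum_abs _ _).trans (sum_le_sum fun t _ => ?_)
    rw [abs_mul, abs_of_nonneg (hq t)]
    exact mul_le_mul_of_nonneg_right (hK s t) (hq t)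
  have hQ : 0 ≤ ∑ t, q t := sum_nonneg fun t _ => hq t
  have hin : ∑ s ∈ C, p s * (∑ t, a s' t * q t - ∑ t, a s t * q t) ≤ (∑ s, p s) * ζ := by
    calc ∑ s ∈ C, p s * (∑ t, a s' t * q t - ∑ t, a s t * q t)
        ≤ ∑ s ∈ C, p s * ζ := sum_le_sum fun s hs =>
          mul_le_mul_of_nonneg_left (by linarith [hC s hs s']) (hp s)
      _ = (∑ s ∈ C, p s) * ζ := by rw [sum_mul]
      _ ≤ _ := mul_le_mul_of_nonneg_right
          (sum_le_sum_of_subset_of_nonneg (subset_univ _) fun s _ _ => hp s) hζ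
  have hout : ∑ s ∈ Cᶜ, p s * (∑ t, a s' t * q t - ∑ t, a s t * q t) ≤
      η * (2 * K * ∑ t, q t) := by
    calc ∑ s ∈ Cᶜ, p s * (∑ t, a s' t * q t - ∑ t, a s t * q t)
        ≤ ∑ s ∈ Cᶜ, p s * (2 * K * ∑ t, q t) := sum_le_sum fun s _ =>
          mul_le_mul_of_nonneg_left (by
            have h1 := (abs_le.1 (hb s')).2
            have h2 := (abs_le.1 (hb s)).1
            linarith) (hp s)
      _ = (∑ s ∈ Cᶜ, p s) * (2 * K * ∑ t, q t) := by rw [sum_mul]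
      _ ≤ _ := mul_le_mul_of_nonneg_right hη (by positivity)
  have hsplit : ∑ s, p s * (∑ t, a s' t * q t - ∑ t, a s t * q t) =
      (∑ s, p s) * ∑ t, a s' t * q t - ∑ s, p s * ∑ t, a s t * q t := by
    simp only [mul_sub, sum_sub_distrib, ← sum_mul]
  have := sum_add_sum_compl C fun s => p s * (∑ t, a s' t * q t - ∑ t, a s t * q t)
  linarith

theorem abs_sum_mul_sub_sum_mul_le {S T : Type*} [Fintype T] {a : S → T → ℝ} {K : ℝ}
    (hK : ∀ s t, |a s t| ≤ K)
    {q q' : T → ℝ} {n : ℝ} (hq : ∀ t, |q t - q' t| ≤ n) (hK0 : 0 ≤ K) (s : S) :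
    |∑ t, a s t * q t - ∑ t, a s t * q' t| ≤ Fintype.card T * (K * n) := by
  rw [← sum_sub_distrib]
  refine (abs_sum_le_sum_abs _ _).trans ?_
  refine (sum_le_card_nsmul univ _ (K * n) fun t _ => ?_).trans ?_
  · rw [← mul_sub, abs_mul]
    exact mul_le_mul (hK s t) (hq t) (abs_nonneg _) hK0
  · rw [card_univ, nsmul_eq_mul]

/-- Every bimatrix game has approximate Nash equilibria.  A grid point of the simplex spanned by
all pure strategies of both players is coloured by a best response of the first player if
the first player has at most half of the mass, and by one of the second player otherwise; at close
grid points of all the colours in `C`, the mass is split nearly equally, nearly all of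
it is on `C`, and the strategies in `C` are nearly best responses. -/
theorem exists_approx_nash_bimatrix {S T : Type*} [Fintype S] [Fintype T] [Nonempty S] [Nonempty T]
    (a b : S → T → ℝ) {ε : ℝ} (hε : 0 < ε) :
    ∃ (p : S → ℝ) (q : T → ℝ), (∀ s, 0 ≤ p s) ∧ (∀ t, 0 ≤ q t) ∧ ∑ s, p s = 1 ∧ ∑ t, q t = 1 ∧
      (∀ s', ∑ t, a s' t * q t ≤ ∑ s, p s * ∑ t, a s t * q t + ε) ∧
      (∀ t', ∑ s, b s t' * p s ≤ ∑ t, q t * ∑ s, b s t * p s + ε) := by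
  obtain ⟨K, hK0, hKa, hKb⟩ : ∃ K : ℝ, 0 ≤ K ∧ (∀ s t, |a s t| ≤ K) ∧ ∀ s t, |b s t| ≤ K := by
    have hnn : ∀ x : S × T, 0 ≤ |a x.1 x.2| + |b x.1 x.2| := fun x => by positivity
    refine ⟨∑ x : S × T, (|a x.1 x.2| + |b x.1 x.2|), sum_nonneg fun x _ => hnn x,
      fun s t => ?_, fun s t => ?_⟩
    · have := single_le_sum (fun x _ => hnn x) (mem_univ (s, t))
      have := abs_nonneg (b s t)
      simp only at *
      linarith
    · have := single_le_sum (fun x _ => hnn x) (mem_univ (s, t))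
      have := abs_nonneg (a s t)
      simp only at *
      linarith
  let n := Fintype.card (S ⊕ T)
  have hnST : n = Fintype.card S + Fintype.card T := Fintype.card_sum
  have hSpos : 0 < Fintype.card S := Fintype.card_pos
  have hTpos : 0 < Fintype.card T := Fintype.card_pos
  obtain ⟨m, hm1, hm2⟩ : ∃ m : ℕ, 4 * n ^ 2 + 1 ≤ m ∧ 64 * K * n ^ 2 ≤ ε * m := by
    obtain ⟨m, hm⟩ := exists_nat_ge (64 * K * n ^ 2 / ε)
    refine ⟨max m (4 * n ^ 2 + 1), le_max_right _ _, ?_⟩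
    rw [div_le_iff₀ hε] at hm
    have : (m : ℝ) ≤ (max m (4 * n ^ 2 + 1) : ℕ) := by exact_mod_cast le_max_left _ _
    nlinarith
  have hbr1 : ∀ v : S ⊕ T → ℕ, ∃ s, ∀ s', ∑ t, a s' t * v (Sum.inr t) ≤
      ∑ t, a s t * v (Sum.inr t) := fun v => by
    obtain ⟨s, -, hs⟩ := exists_max_image univ (fun s => ∑ t, a s t * (v (Sum.inr t) : ℝ))
      univ_nonempty
    exact ⟨s, fun s' => hs s' (mem_univ _)⟩
  have hbr2 : ∀ v : S ⊕ T → ℕ, ∃ t, ∀ t', ∑ s, b s t' * v (Sum.inl s) ≤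
      ∑ s, b s t * v (Sum.inl s) := fun v => by
    obtain ⟨t, -, ht⟩ := exists_max_image univ (fun t => ∑ s, b s t * (v (Sum.inl s) : ℝ))
      univ_nonempty
    exact ⟨t, fun t' => ht t' (mem_univ _)⟩
  choose f hf using hbr1
  choose g hg using hbr2
  have : Nonempty (S ⊕ T) := ⟨Sum.inl (Classical.arbitrary S)⟩
  obtain ⟨C, v, μ, hCne, hv, hμ⟩ := exists_close_grid_points m
    (fun v : S ⊕ T → ℕ => if 2 * ∑ s, v (Sum.inl s) ≤ m then Sum.inl (f v) else Sum.inr (g v))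
  have hCn : C.card ≤ n := card_le_univ C
  rw [sum_add_distrib, sum_const, smul_eq_mul, mul_one] at hμ
  have hsub : ∀ i ∈ C, ∀ D : Finset (S ⊕ T), Disjoint C D →
      ∑ j ∈ C, v i j + ∑ j ∈ D, v i j ≤ m := by
    intro i hi D hD
    rw [← sum_union hD, ← (hv i hi).1]
    exact sum_le_sum_of_subset (subset_univ _)
  have hCle : ∀ i ∈ C, ∑ j ∈ C, μ j ≤ ∑ j ∈ C, v i j := fun i hi =>
    sum_le_sum fun j hj => (hv i hi).2.2 j hj
  have hout : ∀ i ∈ C, ∀ D : Finset (S ⊕ T), Disjoint C D → ∑ j ∈ D, v i j ≤ n := by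
    intro i hi D hD
    have := hsub i hi D hD
    have := hCle i hi
    omega
  have hup : ∀ i ∈ C, ∀ j ∈ C, v i j ≤ μ j + n := by
    intro i hi j hj
    have h1 : ∑ l ∈ C.erase j, μ l ≤ ∑ l ∈ C.erase j, v i l :=
      sum_le_sum fun l hl => (hv i hi).2.2 l (mem_of_mem_erase hl)
    have h2 := add_sum_erase C μ hj
    have h3 := add_sum_erase C (v i) hj
    have h4 := hsub i hi ∅ (disjoint_empty_right _)
    rw [sum_empty] at h4
    omega
  have hclose : ∀ i ∈ C, ∀ i' ∈ C, ∀ j, v i j ≤ v i' j + n := by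
    intro i hi i' hi' j
    by_cases hj : j ∈ C
    · have := hup i hi j hj
      have := (hv i' hi').2.2 j hj
      omega
    · have := hout i hi {j} (disjoint_singleton_right.2 hj)
      rw [sum_singleton] at this
      omega
  have hcloseR : ∀ i ∈ C, ∀ i' ∈ C, ∀ j, |(v i j : ℝ) - v i' j| ≤ n := by
    intro i hi i' hi' j
    have h1 : (v i j : ℝ) ≤ v i' j + n := by exact_mod_cast hclose i hi i' hi' j
    have h2 : (v i' j : ℝ) ≤ v i j + n := by exact_mod_cast hclose i' hi' i hi j
    rw [abs_le]; constructor <;> linarith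
  have hsplit : ∀ i ∈ C, ∑ s, v i (Sum.inl s) + ∑ t, v i (Sum.inr t) = m := fun i hi => by
    rw [← (hv i hi).1, Fintype.sum_sum_type]
  have hlabl : ∀ s, Sum.inl s ∈ C → 2 * ∑ s', v (Sum.inl s) (Sum.inl s') ≤ m ∧
      f (v (Sum.inl s)) = s := by
    intro s hs
    have := (hv _ hs).2.1
    split_ifs at this with h
    exact ⟨h, Sum.inl_injective this⟩
  have hlabr : ∀ t, Sum.inr t ∈ C → m < 2 * ∑ s', v (Sum.inr t) (Sum.inl s') ∧
      g (v (Sum.inr t)) = t := by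
    intro t ht
    have := (hv _ ht).2.1
    split_ifs at this with h
    exact ⟨not_le.1 h, Sum.inr_injective this⟩
  have hnsq : n ≤ n ^ 2 := Nat.le_self_pow two_ne_zero n
  have hexl : ∃ s, Sum.inl s ∈ C := by
    by_contra! hcon
    obtain ⟨i, hi⟩ := hCne
    rcases i with s | t
    · exact hcon s hi
    · have h1 := (hlabr t hi).1
      have h2 := hout _ hi (univ.map ⟨Sum.inl, Sum.inl_injective⟩) (by
        rw [disjoint_right]
        intro x hx
        obtain ⟨s, -, rfl⟩ := mem_map.1 hx
        exact hcon s)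
      rw [sum_map] at h2
      simp only [Function.Embedding.coeFn_mk] at h2
      omega
  have hexr : ∃ t, Sum.inr t ∈ C := by
    by_contra! hcon
    obtain ⟨s, hi⟩ := hexl
    have h1 := (hlabl s hi).1
    have h2 := hout _ hi (univ.map ⟨Sum.inr, Sum.inr_injective⟩) (by
        rw [disjoint_right]
        intro x hx
        obtain ⟨t, -, rfl⟩ := mem_map.1 hx
        exact hcon t)
    rw [sum_map] at h2
    simp only [Function.Embedding.coeFn_mk] at h2
    have := hsplit _ hi
    omega
  obtain ⟨s₀, hs₀⟩ := hexl
  obtain ⟨t₀, ht₀⟩ := hexr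
  let x := v (Sum.inl s₀)
  have hPP : ∑ s, v (Sum.inr t₀) (Sum.inl s) ≤ ∑ s, x (Sum.inl s) + n * n := by
    calc ∑ s, v (Sum.inr t₀) (Sum.inl s) ≤ ∑ s : S, (x (Sum.inl s) + n) :=
          sum_le_sum fun s _ => hclose _ ht₀ _ hs₀ _
      _ = ∑ s, x (Sum.inl s) + Fintype.card S * n := by
          rw [sum_add_distrib, sum_const, smul_eq_mul, card_univ]
      _ ≤ _ := by gcongr; omega
  have hPQ : ∑ s, x (Sum.inl s) + ∑ t, x (Sum.inr t) = m := hsplit _ hs₀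
  have hQ4 : m ≤ 4 * ∑ t, x (Sum.inr t) := by
    have := (hlabl s₀ hs₀).1
    change 2 * ∑ s, x (Sum.inl s) ≤ m at this
    omega
  have hP4 : m ≤ 4 * ∑ s, x (Sum.inl s) := by
    have := (hlabr t₀ ht₀).1
    rw [← sq] at hPP
    omega
  -- `P` and `Q` are the masses of the two players at the grid point `x`
  let P : ℝ := ∑ s, (x (Sum.inl s) : ℝ)
  let Q : ℝ := ∑ t, (x (Sum.inr t) : ℝ)
  have hPQ' : P + Q = m := by
    simp only [P, Q]; exact_mod_cast hPQ
  have hP4' : (m : ℝ) ≤ 4 * P := by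
    simp only [P]; exact_mod_cast hP4
  have hQ4' : (m : ℝ) ≤ 4 * Q := by
    simp only [Q]; exact_mod_cast hQ4
  have hmpos : (0 : ℝ) < m := by
    have : 0 < m := by omega
    exact_mod_cast this
  have hPpos : 0 < P := by linarith
  have hQpos : 0 < Q := by linarith
  have hn1 : (1 : ℝ) ≤ n := by
    have : 1 ≤ n := by omega
    exact_mod_cast this
  have hcS : (Fintype.card S : ℝ) ≤ n := by
    have : Fintype.card S ≤ n := by omega
    exact_mod_cast this
  have hcT : (Fintype.card T : ℝ) ≤ n := by
    have : Fintype.card T ≤ n := by omega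
    exact_mod_cast this
  let ζ : ℝ := 2 * (n * (K * n))
  have hζ0 : 0 ≤ ζ := by positivity
  have hA := mass_mul_le_of_near_best_response hKa (p := fun s => (x (Sum.inl s) : ℝ))
    (q := fun t => (x (Sum.inr t) : ℝ)) (fun _ => Nat.cast_nonneg _) (fun _ => Nat.cast_nonneg _)
    (C := univ.filter fun s => Sum.inl s ∈ C) (η := n) (ζ := ζ)
    (by
      have h2 := hout _ hs₀ ((univ.filter fun s => Sum.inl s ∈ C)ᶜ.map
        ⟨Sum.inl, Sum.inl_injective⟩) (by
          rw [disjoint_right]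
          intro x hx
          obtain ⟨s, hs, rfl⟩ := mem_map.1 hx
          simpa using hs)
      rw [sum_map] at h2
      exact_mod_cast h2) hK0 hζ0
    (by
      intro s hs s'
      have hs := (mem_filter.1 hs).2
      have h1 := hf (v (Sum.inl s)) s'
      rw [(hlabl s hs).2] at h1
      have h2 := fun s' => abs_sum_mul_sub_sum_mul_le hKa
        (q := fun t => (v (Sum.inl s) (Sum.inr t) : ℝ)) (q' := fun t => (x (Sum.inr t) : ℝ))
        (fun t => hcloseR _ hs _ hs₀ (Sum.inr t)) hK0 s'
      have h3 := (abs_le.1 (h2 s)).2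
      have h4 := (abs_le.1 (h2 s')).1
      have h5 : (Fintype.card T : ℝ) * (K * n) ≤ n * (K * n) := by gcongr
      simp only [ζ]
      linarith)
  have hB := mass_mul_le_of_near_best_response (a := fun t s => b s t) (fun t s => hKb s t)
    (p := fun t => (x (Sum.inr t) : ℝ))
    (q := fun s => (x (Sum.inl s) : ℝ)) (fun _ => Nat.cast_nonneg _) (fun _ => Nat.cast_nonneg _)
    (C := univ.filter fun t => Sum.inr t ∈ C) (η := n) (ζ := ζ)
    (by
      have h2 := hout _ hs₀ ((univ.filter fun t => Sum.inr t ∈ C)ᶜ.map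
        ⟨Sum.inr, Sum.inr_injective⟩) (by
          rw [disjoint_right]
          intro x hx
          obtain ⟨s, hs, rfl⟩ := mem_map.1 hx
          simpa using hs)
      rw [sum_map] at h2
      exact_mod_cast h2) hK0 hζ0
    (by
      intro s hs s'
      have hs := (mem_filter.1 hs).2
      have h1 := hg (v (Sum.inr s)) s'
      rw [(hlabr s hs).2] at h1
      have h2 := fun s' => abs_sum_mul_sub_sum_mul_le (a := fun t s => b s t)
        (fun t s => hKb s t)
        (q := fun t => (v (Sum.inr s) (Sum.inl t) : ℝ)) (q' := fun t => (x (Sum.inl t) : ℝ))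
        (fun t => hcloseR _ hs _ hs₀ (Sum.inl t)) hK0 s'
      have h3 := (abs_le.1 (h2 s)).2
      have h4 := (abs_le.1 (h2 s')).1
      have h5 : (Fintype.card S : ℝ) * (K * n) ≤ n * (K * n) := by gcongr
      simp only [ζ]
      linarith)
  -- the error is quadratic in `n` and linear in `m`, the product of the masses is of order `m ^ 2`
  have herr : ∀ Y Z : ℝ, 0 < Y → 0 < Z → Y + Z = m → (m : ℝ) ≤ 4 * Y → (m : ℝ) ≤ 4 * Z →
      Y * ζ + n * (2 * K * Z) ≤ ε * (Y * Z) := by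
    intro Y Z hY hZ hYZ hY4 hZ4
    have h1 : Y * ζ + n * (2 * K * Z) ≤ 4 * K * n ^ 2 * m := by
      have e1 : Y * ζ = 2 * K * n ^ 2 * Y := by simp only [ζ]; ring
      have e2 : n * (2 * K * Z) ≤ 2 * K * n ^ 2 * Z := by
        have : (n : ℝ) * (2 * K * Z) ≤ n * (n * (2 * K * Z)) := by
          refine le_mul_of_one_le_left (by positivity) hn1
        calc _ ≤ _ := this
          _ = _ := by ring
      have e3 : 2 * K * n ^ 2 * Y + 2 * K * n ^ 2 * Z = 2 * K * n ^ 2 * m := by rw [← hYZ]; ring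
      have e4 : 0 ≤ K * n ^ 2 * m := by positivity
      linarith
    have h2 : (m : ℝ) * m ≤ 16 * (Y * Z) := by nlinarith
    have h3 : 64 * K * n ^ 2 * m ≤ ε * m * m := by gcongr
    nlinarith
  have hAB := herr P Q hPpos hQpos hPQ' hP4' hQ4'
  have hBA := herr Q P hQpos hPpos (by linarith) hQ4' hP4'
  refine ⟨fun s => x (Sum.inl s) / P, fun t => x (Sum.inr t) / Q, fun s => by positivity,
    fun t => by positivity, ?_, ?_, fun s' => ?_, fun t' => ?_⟩
  · rw [← sum_div, div_self hPpos.ne']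
  · rw [← sum_div, div_self hQpos.ne']
  · have h := hA s'
    change P * _ ≤ _ + (P * ζ + n * (2 * K * Q)) at h
    have e1 : ∀ s, ∑ t, a s t * (x (Sum.inr t) / Q) = (∑ t, a s t * x (Sum.inr t)) / Q := by
      intro s; rw [sum_div]; exact sum_congr rfl fun t _ => by ring
    simp only [e1]
    have e2 : ∑ s, x (Sum.inl s) / P * ((∑ t, a s t * x (Sum.inr t)) / Q) =
        (∑ s, x (Sum.inl s) * ∑ t, a s t * x (Sum.inr t)) / (P * Q) := by
      rw [sum_div]; exact sum_congr rfl fun s _ => by rw [div_mul_div_comm]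
    rw [e2, div_add' _ _ _ (by positivity), div_le_div_iff₀ hQpos (by positivity)]
    have h' : P * ∑ t, a s' t * x (Sum.inr t) ≤
      ∑ s, x (Sum.inl s) * ∑ t, a s t * x (Sum.inr t) + ε * (P * Q) := by linarith
    nlinarith
  · have h := hB t'
    change Q * _ ≤ _ + (Q * ζ + n * (2 * K * P)) at h
    have e1 : ∀ t, ∑ s, b s t * (x (Sum.inl s) / P) = (∑ s, b s t * x (Sum.inl s)) / P := by
      intro s; rw [sum_div]; exact sum_congr rfl fun t _ => by ring
    simp only [e1]
    have e2 : ∑ t, x (Sum.inr t) / Q * ((∑ s, b s t * x (Sum.inl s)) / P) =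
        (∑ t, x (Sum.inr t) * ∑ s, b s t * x (Sum.inl s)) / (P * Q) := by
      rw [sum_div]; exact sum_congr rfl fun s _ => by rw [div_mul_div_comm, mul_comm Q]
    rw [e2, div_add' _ _ _ (by positivity), div_le_div_iff₀ hPpos (by positivity)]
    have h' : Q * ∑ s, b s t' * x (Sum.inl s) ≤
      ∑ t, x (Sum.inr t) * ∑ s, b s t * x (Sum.inl s) + ε * (P * Q) := by linarith
    nlinarith

end Nash

section Nash

open Finset

/-- `exists_approx_nash_bimatrix` for strategies from finite sets. -/
theorem exists_approx_nash_finset {S T : Type*} (P : Finset S) (Q : Finset T) (hP : P.Nonempty)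
    (hQ : Q.Nonempty) (a b : S → T → ℝ) {ε : ℝ} (hε : 0 < ε) :
    ∃ (p : S → ℝ) (q : T → ℝ), (∀ s ∈ P, 0 ≤ p s) ∧ (∀ t ∈ Q, 0 ≤ q t) ∧
      ∑ s ∈ P, p s = 1 ∧ ∑ t ∈ Q, q t = 1 ∧
      (∀ s' ∈ P, ∑ t ∈ Q, q t * a s' t ≤ ∑ s ∈ P, p s * ∑ t ∈ Q, q t * a s t + ε) ∧
      (∀ t' ∈ Q, ∑ s ∈ P, p s * b s t' ≤ ∑ t ∈ Q, q t * ∑ s ∈ P, p s * b s t + ε) := by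
  classical
  have := hP.to_subtype
  have := hQ.to_subtype
  obtain ⟨p, q, hp, hq, hp1, hq1, h1, h2⟩ :=
    exists_approx_nash_bimatrix (fun (s : P) (t : Q) => a s t) (fun s t => b s t) hε
  let p' : S → ℝ := fun s => if h : s ∈ P then p ⟨s, h⟩ else 0
  let q' : T → ℝ := fun t => if h : t ∈ Q then q ⟨t, h⟩ else 0
  have hp' : ∀ s : P, p' s = p s := fun s => dif_pos s.2
  have hq' : ∀ t : Q, q' t = q t := fun t => dif_pos t.2
  refine ⟨p', q', fun s hs => ?_, fun t ht => ?_, ?_, ?_, fun s' hs' => ?_, fun t' ht' => ?_⟩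
  · rw [hp' ⟨s, hs⟩]; exact hp _
  · rw [hq' ⟨t, ht⟩]; exact hq _
  · rw [← sum_coe_sort, ← hp1]; exact sum_congr rfl fun s _ => hp' s
  · rw [← sum_coe_sort, ← hq1]; exact sum_congr rfl fun t _ => hq' t
  · have := h1 ⟨s', hs'⟩
    simp only [← sum_coe_sort P, ← sum_coe_sort Q, hp', hq']
    simpa only [mul_comm (q _)] using this
  · have := h2 ⟨t', ht'⟩
    simp only [← sum_coe_sort P, ← sum_coe_sort Q, hp', hq']
    simpa only [mul_comm (p _)] using this

end Nash

/-! ### Sampling from a finite distribution -/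

section Sampling

open Finset

/-- Hoeffding's lemma for a finite distribution. -/
theorem sum_mul_exp_le {S : Type*} {P : Finset S} {w f : S → ℝ} (hw : ∀ t ∈ P, 0 ≤ w t)
    (hw1 : ∑ t ∈ P, w t = 1) {c : ℝ} (hc : 0 < c) (hf : ∀ t ∈ P, |f t| ≤ c)
    (hf0 : ∑ t ∈ P, w t * f t = 0) (l : ℝ) :
    ∑ t ∈ P, w t * Real.exp (l * f t) ≤ Real.exp (l ^ 2 * c ^ 2 / 2) := by
  -- the chord of the convex function `exp` over `[-l * c, l * c]`
  have hchord : ∀ t ∈ P, Real.exp (l * f t) ≤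
      Real.cosh (l * c) + f t / c * Real.sinh (l * c) := by
    intro t ht
    obtain ⟨h1, h2⟩ := abs_le.1 (hf t ht)
    have hn1 : 0 ≤ (1 + f t / c) / 2 := by
      have : -1 ≤ f t / c := by rw [le_div_iff₀ hc]; linarith
      linarith
    have hn2 : 0 ≤ (1 - f t / c) / 2 := by
      have : f t / c ≤ 1 := by rw [div_le_iff₀ hc]; linarith
      linarith
    have hcv := convexOn_exp.2 (Set.mem_univ (l * c)) (Set.mem_univ (-(l * c))) hn1 hn2 (by ring)
    simp only [smul_eq_mul] at hcv
    have e : (1 + f t / c) / 2 * (l * c) + (1 - f t / c) / 2 * -(l * c) = l * f t := by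
      field_simp
      ring
    rw [e] at hcv
    rw [Real.cosh_eq, Real.sinh_eq]
    linarith
  calc ∑ t ∈ P, w t * Real.exp (l * f t)
      ≤ ∑ t ∈ P, w t * (Real.cosh (l * c) + f t / c * Real.sinh (l * c)) :=
        sum_le_sum fun t ht => mul_le_mul_of_nonneg_left (hchord t ht) (hw t ht)
    _ = (∑ t ∈ P, w t) * Real.cosh (l * c) +
          (∑ t ∈ P, w t * f t) * (Real.sinh (l * c) / c) := by
        rw [sum_mul, sum_mul, ← sum_add_distrib]
        exact sum_congr rfl fun t _ => by ring
    _ = Real.cosh (l * c) := by rw [hw1, hf0]; ring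
    _ ≤ Real.exp ((l * c) ^ 2 / 2) := Real.cosh_le_exp_half_sq _
    _ = _ := by rw [mul_pow]

/-- The samples can be chosen one after the other so that an exponential potential of the
deviations grows at most by the factor from Hoeffding's lemma in each step. -/
theorem exists_samples_potential_le {S κ : Type*} {P : Finset S} {w : S → ℝ}
    (hw : ∀ t ∈ P, 0 ≤ w t) (hw1 : ∑ t ∈ P, w t = 1) (Q : Finset κ) {f : κ → S → ℝ} {c : ℝ}
    (hc : 0 < c) (hf : ∀ q ∈ Q, ∀ t ∈ P, |f q t| ≤ c)
    (hf0 : ∀ q ∈ Q, ∑ t ∈ P, w t * f q t = 0) (l : ℝ) (k : ℕ) :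
    ∃ τ : ℕ → S, (∀ m, τ m ∈ P) ∧
      ∑ q ∈ Q, (Real.exp (l * ∑ m ∈ range k, f q (τ m)) +
        Real.exp (-l * ∑ m ∈ range k, f q (τ m))) ≤
      2 * Q.card * Real.exp (l ^ 2 * c ^ 2 / 2) ^ k := by
  classical
  have hP : P.Nonempty := by
    rw [nonempty_iff_ne_empty]
    rintro rfl
    simp at hw1
  induction k with
  | zero =>
    obtain ⟨t, ht⟩ := hP
    refine ⟨fun _ => t, fun _ => ht, ?_⟩
    simp only [range_zero, sum_empty, mul_zero, Real.exp_zero, pow_zero]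
    rw [sum_const, nsmul_eq_mul]
    linarith
  | succ k ih =>
    obtain ⟨τ, hτ, hpot⟩ := ih
    set V : κ → ℝ := fun q => ∑ m ∈ range k, f q (τ m) with hV
    let Φ : S → ℝ := fun t => ∑ q ∈ Q, (Real.exp (l * (V q + f q t)) +
      Real.exp (-l * (V q + f q t)))
    have havg : ∑ t ∈ P, w t * Φ t ≤ 2 * Q.card * Real.exp (l ^ 2 * c ^ 2 / 2) ^ (k + 1) := by
      calc ∑ t ∈ P, w t * Φ t
          = ∑ q ∈ Q, (Real.exp (l * V q) * ∑ t ∈ P, w t * Real.exp (l * f q t) +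
              Real.exp (-l * V q) * ∑ t ∈ P, w t * Real.exp (-l * f q t)) := by
            simp only [Φ, mul_sum, ← sum_add_distrib]
            rw [sum_comm]
            refine sum_congr rfl fun q _ => sum_congr rfl fun t _ => ?_
            rw [mul_add l, mul_add (-l), Real.exp_add, Real.exp_add]
            ring
        _ ≤ ∑ q ∈ Q, (Real.exp (l * V q) * Real.exp (l ^ 2 * c ^ 2 / 2) +
              Real.exp (-l * V q) * Real.exp (l ^ 2 * c ^ 2 / 2)) := by
            refine sum_le_sum fun q hq => ?_
            have h1 := sum_mul_exp_le hw hw1 hc (hf q hq) (hf0 q hq) l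
            have h2 := sum_mul_exp_le hw hw1 hc (hf q hq) (hf0 q hq) (-l)
            rw [neg_sq] at h2
            gcongr
        _ = (∑ q ∈ Q, (Real.exp (l * V q) + Real.exp (-l * V q))) *
              Real.exp (l ^ 2 * c ^ 2 / 2) := by
            rw [sum_mul]; exact sum_congr rfl fun q _ => by ring
        _ ≤ _ := by
            rw [pow_succ _ k, ← mul_assoc]
            exact mul_le_mul_of_nonneg_right hpot (Real.exp_pos _).le
    obtain ⟨t, ht, hΦ⟩ : ∃ t ∈ P, Φ t ≤ ∑ t ∈ P, w t * Φ t := by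
      obtain ⟨t, ht, hmin⟩ := exists_min_image P Φ hP
      refine ⟨t, ht, ?_⟩
      calc Φ t = ∑ t' ∈ P, w t' * Φ t := by rw [← sum_mul, hw1, one_mul]
        _ ≤ _ := sum_le_sum fun t' ht' => mul_le_mul_of_nonneg_left (hmin t' ht') (hw t' ht')
    refine ⟨Function.update τ k t, fun m => ?_, ?_⟩
    · rcases eq_or_ne m k with rfl | hm
      · simpa using ht
      · rw [Function.update_of_ne hm]; exact hτ m
    · have hsum : ∀ q, ∑ m ∈ range (k + 1), f q (Function.update τ k t m) = V q + f q t := by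
        intro q
        rw [sum_range_succ, Function.update_self, hV]
        congr 1
        refine sum_congr rfl fun m hm => ?_
        rw [Function.update_of_ne (mem_range.1 hm).ne]
      simp only [hsum]
      exact hΦ.trans havg

/-- If `k` is large, then the means of the functions `f q` under a distribution are approximated up
to `δ` by their averages over some sample of size `k`. -/
theorem exists_samples_abs_sub_le {S κ : Type*} {P : Finset S} {w : S → ℝ}
    (hw : ∀ t ∈ P, 0 ≤ w t) (hw1 : ∑ t ∈ P, w t = 1) (Q : Finset κ) {f : κ → S → ℝ} {c : ℝ}
    (hc : 0 < c) (hf : ∀ q ∈ Q, ∀ t ∈ P, |f q t| ≤ c) {δ : ℝ} (hδ : 0 < δ) {k : ℕ}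
    (hk : 8 * c ^ 2 * Real.log (2 * Q.card) ≤ k * δ ^ 2) :
    ∃ τ : ℕ → S, (∀ m, τ m ∈ P) ∧ ∀ q ∈ Q,
      |∑ m ∈ range k, f q (τ m) - k * ∑ t ∈ P, w t * f q t| ≤ k * δ := by
  let F : κ → S → ℝ := fun q t => f q t - ∑ t ∈ P, w t * f q t
  have hmean : ∀ q ∈ Q, |∑ t ∈ P, w t * f q t| ≤ c := by
    intro q hq
    calc |∑ t ∈ P, w t * f q t| ≤ ∑ t ∈ P, w t * c := by
          refine (abs_sum_le_sum_abs _ _).trans (sum_le_sum fun t ht => ?_)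
          rw [abs_mul, abs_of_nonneg (hw t ht)]
          exact mul_le_mul_of_nonneg_left (hf q hq t ht) (hw t ht)
      _ = c := by rw [← sum_mul, hw1, one_mul]
  -- the choice that balances the two terms of the bound
  let l : ℝ := δ / (2 * c) ^ 2
  have hl : 0 < l := by positivity
  obtain ⟨τ, hτ, hpot⟩ := exists_samples_potential_le hw hw1 Q (f := F) (c := 2 * c) (by positivity)
    (fun q hq t ht => by
      calc |F q t| ≤ |f q t| + |∑ t ∈ P, w t * f q t| := abs_sub _ _
        _ ≤ 2 * c := by linarith [hf q hq t ht, hmean q hq])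
    (fun q _ => by
      simp only [F, mul_sub, sum_sub_distrib, ← sum_mul, hw1, one_mul, sub_self]) l k
  refine ⟨τ, hτ, fun q hq => ?_⟩
  have hsum : ∑ m ∈ range k, F q (τ m) =
      ∑ m ∈ range k, f q (τ m) - k * ∑ t ∈ P, w t * f q t := by
    simp only [F, sum_sub_distrib, sum_const, card_range, nsmul_eq_mul]
  rw [← hsum]
  set V := ∑ m ∈ range k, F q (τ m) with hV
  have hQpos : (0 : ℝ) < 2 * Q.card := by
    have : 0 < Q.card := card_pos.2 ⟨q, hq⟩
    positivity
  have h1 : Real.exp (l * |V|) ≤ 2 * Q.card * Real.exp (l ^ 2 * (2 * c) ^ 2 / 2) ^ k := by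
    have hterm := single_le_sum (f := fun q => Real.exp (l * ∑ m ∈ range k, F q (τ m)) +
        Real.exp (-l * ∑ m ∈ range k, F q (τ m))) (fun q _ => by positivity) hq
    refine le_trans ?_ (hterm.trans hpot)
    rcases abs_cases V with ⟨h, -⟩ | ⟨h, -⟩
    · rw [h]; exact le_add_of_nonneg_right (Real.exp_pos _).le
    · rw [h, mul_neg, ← neg_mul]; exact le_add_of_nonneg_left (Real.exp_pos _).le
  have h2 : l * |V| ≤ Real.log (2 * Q.card) + k * (l ^ 2 * (2 * c) ^ 2 / 2) := by
    rw [← Real.log_exp (l * |V|)]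
    refine (Real.log_le_log (Real.exp_pos _) h1).trans_eq ?_
    rw [Real.log_mul hQpos.ne' (by positivity), Real.log_pow, Real.log_exp]
  have h3 : Real.log (2 * Q.card) ≤ k * δ * l / 2 := by
    have : k * δ * l / 2 = k * δ ^ 2 / (8 * c ^ 2) := by
      simp only [l]; field_simp; norm_num
    rw [this, le_div_iff₀ (by positivity)]
    linarith
  have h4 : k * (l ^ 2 * (2 * c) ^ 2 / 2) = k * δ * l / 2 := by
    simp only [l]; field_simp
  rw [h4] at h2
  have h5 : l * |V| ≤ l * (k * δ) := by linarith
  exact le_of_mul_le_mul_left h5 hl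

end Sampling

/-! ### Reach probabilities, Kuhn's theorem and pure strategies -/

namespace ExtensiveForm

namespace GameTree

open scoped Classical
open Finset

section Basic

variable {ι A J : Type*} {G : GameTree ι A J} {i : ι} {s t : J → A → ℝ} {h z : List A} {a : A}

theorem mem_actions : a ∈ G.actions h ↔ a :: h ∈ G.nodes := mem_preimage

theorem mem_nodes_of_suffix (hz : z ∈ G.nodes) (hs : h <:+ z) : h ∈ G.nodes := by
  induction z with
  | nil => rwa [List.suffix_nil.1 hs]
  | cons a z ih =>
    rcases List.suffix_cons_iff.1 hs with rfl | hs
    · exact hz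
    · exact ih (G.parent_mem a z hz) hs

theorem actions_eq_of_info_eq {h' : List A} (hd : G.Decision i h) (hd' : G.Decision i h')
    (hi : G.info h = G.info h') : G.actions h = G.actions h' := by
  ext a
  rw [mem_actions, mem_actions]
  exact G.same_actions i h h' hd.1 hd'.1 hd.2 hd'.2 hi a

theorem mem_nodes_of_mem_leaves (hz : z ∈ G.leaves) : z ∈ G.nodes := (mem_filter.1 hz).1

theorem not_internal_of_mem_leaves (hz : z ∈ G.leaves) : ¬ G.Internal z := (mem_filter.1 hz).2

theorem mem_leaves : z ∈ G.leaves ↔ z ∈ G.nodes ∧ ¬ G.Internal z := mem_filter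

theorem eq_of_leaf_suffix (hh : h ∈ G.leaves) (hz : z ∈ G.nodes) (hs : h <:+ z) : z = h := by
  obtain ⟨u, rfl⟩ := hs
  rcases List.eq_nil_or_concat u with rfl | ⟨u', a, rfl⟩
  · rfl
  · refine absurd ⟨a, mem_nodes_of_suffix hz ⟨u', ?_⟩⟩ (not_internal_of_mem_leaves hh)
    simp

/-- A property that can be passed on to some child holds at some leaf. -/
theorem exists_leaf_of_hereditary (p : List A → Prop) (hh : h ∈ G.nodes) (hp : p h)
    (hstep : ∀ h', G.Internal h' → p h' → ∃ a, a :: h' ∈ G.nodes ∧ p (a :: h')) :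
    ∃ z ∈ G.leaves, h <:+ z ∧ p z := by
  obtain ⟨z, hz, hmax⟩ := exists_max_image (G.nodes.filter fun z => h <:+ z ∧ p z) List.length
    ⟨h, mem_filter.2 ⟨hh, List.suffix_rfl, hp⟩⟩
  obtain ⟨hzn, hhz, hpz⟩ := mem_filter.1 hz
  refine ⟨z, mem_leaves.2 ⟨hzn, fun hint => ?_⟩, hhz, hpz⟩
  obtain ⟨a, ha, hpa⟩ := hstep z hint hpz
  have := hmax (a :: z) (mem_filter.2 ⟨ha, hhz.trans (List.suffix_cons a z), hpa⟩)
  simp at this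

theorem reach_cons_of_eq (hp : G.player h = some i) :
    G.reach i s (a :: h) = G.reach i s h * s (G.info h) a := by
  rw [reach, if_pos hp]

theorem reach_cons_of_ne (hp : G.player h ≠ some i) :
    G.reach i s (a :: h) = G.reach i s h := by
  rw [reach, if_neg hp, mul_one]

theorem seq_cons_of_eq (hp : G.player h = some i) :
    G.seq i (a :: h) = (G.info h, a) :: G.seq i h := by
  rw [seq, if_pos hp]

theorem seq_cons_of_ne (hp : G.player h ≠ some i) : G.seq i (a :: h) = G.seq i h := by
  rw [seq, if_neg hp]

theorem seq_suffix_seq (hs : h <:+ z) : G.seq i h <:+ G.seq i z := by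
  induction z with
  | nil => rw [List.suffix_nil.1 hs]
  | cons a z ih =>
    rcases List.suffix_cons_iff.1 hs with rfl | hs
    · exact List.suffix_rfl
    · refine (ih hs).trans ?_
      by_cases hp : G.player z = some i
      · rw [seq_cons_of_eq hp]; exact List.suffix_cons _ _
      · rw [seq_cons_of_ne hp]

theorem reach_eq_prod_seq : G.reach i s h = ((G.seq i h).map fun x => s x.1 x.2).prod := by
  induction h with
  | nil => rfl
  | cons a h ih =>
    by_cases hp : G.player h = some i
    · rw [reach_cons_of_eq hp, seq_cons_of_eq hp, List.map_cons, List.prod_cons, ih, mul_comm]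
    · rw [reach_cons_of_ne hp, seq_cons_of_ne hp, ih]

theorem reach_eq_of_seq_eq {h' : List A} (hs : G.seq i h = G.seq i h') :
    G.reach i s h = G.reach i s h' := by
  rw [reach_eq_prod_seq, reach_eq_prod_seq, hs]

theorem reach_congr (hst : ∀ h a, a :: h <:+ z → G.player h = some i →
    s (G.info h) a = t (G.info h) a) : G.reach i s z = G.reach i t z := by
  induction z with
  | nil => rfl
  | cons a z ih =>
    have ih' := ih fun h' a' hs hp => hst h' a' (hs.trans (List.suffix_cons a z)) hp
    by_cases hp : G.player z = some i
    · rw [reach_cons_of_eq hp, reach_cons_of_eq hp, ih', hst z a List.suffix_rfl hp]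
    · rw [reach_cons_of_ne hp, reach_cons_of_ne hp, ih']

theorem reach_nonneg (hs : G.IsStrategy i s) (hh : h ∈ G.nodes) : 0 ≤ G.reach i s h := by
  induction h with
  | nil => exact zero_le_one
  | cons a h ih =>
    have ih' := ih (G.parent_mem a h hh)
    by_cases hp : G.player h = some i
    · rw [reach_cons_of_eq hp]
      exact mul_nonneg ih' ((hs h ⟨⟨a, hh⟩, hp⟩).1 a (mem_actions.2 hh))
    · rwa [reach_cons_of_ne hp]

theorem reach_pos_of_cons (hs : G.IsStrategy i s) (hh : a :: h ∈ G.nodes)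
    (hr : 0 < G.reach i s (a :: h)) : 0 < G.reach i s h := by
  refine lt_of_le_of_ne (reach_nonneg hs (G.parent_mem a h hh)) fun h0 => hr.ne' ?_
  rw [reach, ← h0, zero_mul]

theorem reach_pos_of_suffix (hs : G.IsStrategy i s) (hz : z ∈ G.nodes)
    (hr : 0 < G.reach i s z) (hhz : h <:+ z) : 0 < G.reach i s h := by
  induction z with
  | nil => rwa [List.suffix_nil.1 hhz]
  | cons a z ih =>
    rcases List.suffix_cons_iff.1 hhz with rfl | hhz
    · exact hr
    · exact ih (G.parent_mem a z hz) (reach_pos_of_cons hs hz hr) hhz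

theorem action_pos_of_reach_pos (hs : G.IsStrategy i s) (hh : a :: h ∈ G.nodes)
    (hp : G.player h = some i) (hr : 0 < G.reach i s (a :: h)) : 0 < s (G.info h) a := by
  rw [reach_cons_of_eq hp] at hr
  exact pos_of_mul_pos_right hr (reach_nonneg hs (G.parent_mem a h hh))

theorem reach_eq_zero_or_one (hs : G.IsPureStrategy i s) (hh : h ∈ G.nodes) :
    G.reach i s h = 0 ∨ G.reach i s h = 1 := by
  induction h with
  | nil => exact Or.inr rfl
  | cons a h ih =>
    have ih' := ih (G.parent_mem a h hh)
    by_cases hp : G.player h = some i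
    · rw [reach_cons_of_eq hp]
      rcases ih' with h0 | h1
      · left; rw [h0, zero_mul]
      · rw [h1, one_mul]
        exact hs.2 h ⟨⟨a, hh⟩, hp⟩ a (mem_actions.2 hh)
    · rwa [reach_cons_of_ne hp]

theorem IsPureStrategy.eq_of_pos (hs : G.IsPureStrategy i s) (hd : G.Decision i h) {a' : A}
    (ha : a ∈ G.actions h) (ha' : a' ∈ G.actions h) (hpos : 0 < s (G.info h) a)
    (hpos' : 0 < s (G.info h) a') : a = a' := by
  by_contra hne
  have h1 := (hs.2 h hd a ha).resolve_left hpos.ne'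
  have h2 := (hs.2 h hd a' ha').resolve_left hpos'.ne'
  have hle := sum_le_sum_of_subset_of_nonneg (f := s (G.info h)) (s := {a, a'})
    (t := G.actions h) (by
      intro x hx
      rcases mem_insert.1 hx with rfl | hx
      · exact ha
      · rwa [mem_singleton.1 hx]) (fun x hx _ => (hs.1 h hd).1 x hx)
  rw [(hs.1 h hd).2, sum_pair hne, h1, h2] at hle
  norm_num at hle

theorem exists_child_reach_pos (hs : G.IsStrategy i s) (hint : G.Internal h)
    (hr : 0 < G.reach i s h) : ∃ a, a :: h ∈ G.nodes ∧ 0 < G.reach i s (a :: h) := by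
  by_cases hp : G.player h = some i
  · obtain ⟨h0, h1⟩ := hs h ⟨hint, hp⟩
    obtain ⟨a, ha, hpos⟩ : ∃ a ∈ G.actions h, 0 < s (G.info h) a := by
      by_contra! hcon
      have := sum_nonpos hcon
      linarith
    exact ⟨a, mem_actions.1 ha, by rw [reach_cons_of_eq hp]; exact mul_pos hr hpos⟩
  · obtain ⟨a, ha⟩ := hint
    exact ⟨a, ha, by rwa [reach_cons_of_ne hp]⟩

/-- Under perfect recall, no information set is met twice on a path. -/
theorem PerfectRecall.info_ne (hG : G.PerfectRecall) (hd : G.Decision i z)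
    (hs : a :: h <:+ z) (hp : G.player h = some i) : G.info h ≠ G.info z := by
  intro he
  have hz : z ∈ G.nodes := by
    obtain ⟨b, hb⟩ := hd.1
    exact G.parent_mem b z hb
  have h1 := hG i h z ⟨⟨a, mem_nodes_of_suffix hz hs⟩, hp⟩ hd he
  have h2 := (seq_suffix_seq (G := G) (i := i) hs).length_le
  rw [seq_cons_of_eq hp, h1, List.length_cons] at h2
  omega

theorem exists_isPureStrategy (G : GameTree ι A J) (i : ι) : ∃ s, G.IsPureStrategy i s := by
  let Q : J → A → Prop := fun j a => ∃ h, G.Decision i h ∧ G.info h = j ∧ a ∈ G.actions h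
  let s : J → A → ℝ := fun j a => if hj : ∃ a, Q j a then (if a = hj.choose then 1 else 0) else 0
  have hs : ∀ h, G.Decision i h → ∃ a₀ ∈ G.actions h, ∀ a,
      s (G.info h) a = if a = a₀ then 1 else 0 := by
    intro h hd
    have hj : ∃ a, Q (G.info h) a := by
      obtain ⟨a, ha⟩ := hd.1
      exact ⟨a, h, hd, rfl, mem_actions.2 ha⟩
    refine ⟨hj.choose, ?_, fun a => dif_pos hj⟩
    obtain ⟨h', hd', hi, ha⟩ := hj.choose_spec
    rwa [actions_eq_of_info_eq hd hd' hi.symm]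
  refine ⟨s, fun h hd => ?_, fun h hd a _ => ?_⟩
  · obtain ⟨a₀, ha₀, hs⟩ := hs h hd
    refine ⟨fun a _ => ?_, ?_⟩
    · rw [hs]; split_ifs <;> norm_num
    · simp only [hs, sum_ite_eq', if_pos ha₀]
  · obtain ⟨a₀, -, hs⟩ := hs h hd
    rw [hs]
    split_ifs
    · exact Or.inr rfl
    · exact Or.inl rfl

/-- Finitely many pure strategies represent all of them up to reach probabilities. -/
theorem exists_finset_pureStrategies (G : GameTree ι A J) (i : ι) :
    ∃ P : Finset (J → A → ℝ), P.Nonempty ∧ (∀ s ∈ P, G.IsPureStrategy i s) ∧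
      ∀ t, G.IsPureStrategy i t → ∃ s ∈ P, ∀ h ∈ G.nodes, G.reach i t h = G.reach i s h := by
  -- a pure strategy has reach probabilities `0` and `1`, which leaves finitely many patterns
  let f : (J → A → ℝ) → G.nodes → Prop := fun s h => G.reach i s h = 1
  obtain ⟨u, hu, hbij⟩ := Set.exists_subset_bijOn {s | G.IsPureStrategy i s} f
  have hfin : u.Finite := Set.Finite.of_finite_image (Set.toFinite _) hbij.injOn
  have hrep : ∀ t, G.IsPureStrategy i t → ∃ s ∈ hfin.toFinset,
      ∀ h ∈ G.nodes, G.reach i t h = G.reach i s h := by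
    intro t ht
    have : f t ∈ f '' u := by rw [hbij.image_eq]; exact ⟨t, ht, rfl⟩
    obtain ⟨s, hs, hst⟩ := this
    refine ⟨s, hfin.mem_toFinset.2 hs, fun h hh => ?_⟩
    have he : (G.reach i s h = 1) = (G.reach i t h = 1) := congrFun hst ⟨h, hh⟩
    rcases reach_eq_zero_or_one ht hh with h0 | h1
    · rcases reach_eq_zero_or_one (hu hs) hh with h0' | h1'
      · rw [h0, h0']
      · rw [he] at h1'
        rw [h0] at h1'
        norm_num at h1'
    · rw [← he] at h1
      rw [h1, ← he, h1]
  obtain ⟨t, ht⟩ := G.exists_isPureStrategy i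
  obtain ⟨s, hs, -⟩ := hrep t ht
  exact ⟨hfin.toFinset, ⟨s, hs⟩, fun s hs => hu (hfin.mem_toFinset.1 hs), hrep⟩

/-- A reach probability is affine in the distribution used at a single information set, since
this is met only once. -/
theorem PerfectRecall.reach_eq_sum_update (hG : G.PerfectRecall) {h₀ : List A}
    (hd : G.Decision i h₀) (hs : ∑ a ∈ G.actions h₀, s (G.info h₀) a = 1) (hz : z ∈ G.nodes) :
    G.reach i s z = ∑ a ∈ G.actions h₀, s (G.info h₀) a *
      G.reach i (Function.update s (G.info h₀) fun x => if x = a then 1 else 0) z := by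
  induction z with
  | nil => simpa [reach] using hs.symm
  | cons a z ih =>
    have ih' := ih (G.parent_mem a z hz)
    by_cases hp : G.player z = some i
    · have hdz : G.Decision i z := ⟨⟨a, hz⟩, hp⟩
      simp only [reach_cons_of_eq hp]
      by_cases hi : G.info z = G.info h₀
      · have hu : ∀ a', G.reach i (Function.update s (G.info h₀) fun x => if x = a' then 1 else 0) z
            = G.reach i s z := fun a' => reach_congr fun h' x hsx hp' => by
          rw [Function.update_of_ne]
          rw [← hi]
          exact hG.info_ne hdz hsx hp'
        have ha : a ∈ G.actions h₀ := by
          rw [actions_eq_of_info_eq hd hdz hi.symm]; exact mem_actions.2 hz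
        simp only [hu, hi, Function.update_self, mul_ite, mul_one, mul_zero, sum_ite_eq, if_pos ha]
        ring
      · simp only [Function.update_of_ne hi]
        rw [ih', sum_mul]
        exact sum_congr rfl fun x _ => by ring
    · simp only [reach_cons_of_ne hp]
      exact ih'

/-- Some pure strategy does at least as well as a given behavior strategy: the strategy can
be made pure at one information set after the other. -/
theorem PerfectRecall.exists_pure_le (hG : G.PerfectRecall) (hs : G.IsStrategy i s)
    (c : List A → ℝ) : ∃ t, G.IsPureStrategy i t ∧
      ∑ z ∈ G.leaves, G.reach i s z * c z ≤ ∑ z ∈ G.leaves, G.reach i t z * c z := by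
  have key : ∀ F : Finset J, ∃ t, G.IsStrategy i t ∧
      (∀ h, G.Decision i h → G.info h ∈ F → ∀ a ∈ G.actions h,
        t (G.info h) a = 0 ∨ t (G.info h) a = 1) ∧
      ∑ z ∈ G.leaves, G.reach i s z * c z ≤ ∑ z ∈ G.leaves, G.reach i t z * c z := by
    intro F
    induction F using Finset.induction_on with
    | empty => exact ⟨s, hs, fun h _ hh => absurd hh (notMem_empty _), le_rfl⟩
    | insert j F _ ih =>
      obtain ⟨t, ht, htF, hst⟩ := ih
      by_cases hj : ∃ h₀, G.Decision i h₀ ∧ G.info h₀ = j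
      · obtain ⟨h₀, hd, rfl⟩ := hj
        let U : A → J → A → ℝ := fun a =>
          Function.update t (G.info h₀) fun x => if x = a then 1 else 0
        let V : (J → A → ℝ) → ℝ := fun t => ∑ z ∈ G.leaves, G.reach i t z * c z
        have hV : V t = ∑ a ∈ G.actions h₀, t (G.info h₀) a * V (U a) := by
          simp only [V, mul_sum]
          rw [sum_comm]
          refine sum_congr rfl fun z hz => ?_
          rw [hG.reach_eq_sum_update hd (ht h₀ hd).2 (mem_nodes_of_mem_leaves hz), sum_mul]
          exact sum_congr rfl fun a _ => by simp only [U]; ring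
        obtain ⟨a, ha, hVa⟩ : ∃ a ∈ G.actions h₀, V t ≤ V (U a) := by
          obtain ⟨a, ha, hmax⟩ := exists_max_image (G.actions h₀) (fun a => V (U a)) (by
            obtain ⟨a, ha⟩ := hd.1
            exact ⟨a, mem_actions.2 ha⟩)
          refine ⟨a, ha, ?_⟩
          calc V t ≤ ∑ a' ∈ G.actions h₀, t (G.info h₀) a' * V (U a) := by
                rw [hV]
                exact sum_le_sum fun a' ha' =>
                  mul_le_mul_of_nonneg_left (hmax a' ha') ((ht h₀ hd).1 a' ha')
            _ = V (U a) := by rw [← sum_mul, (ht h₀ hd).2, one_mul]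
        refine ⟨U a, fun h hh => ?_, fun h hh hF a' ha' => ?_, hst.trans hVa⟩
        · by_cases hi : G.info h = G.info h₀
          · rw [actions_eq_of_info_eq hh hd hi]
            simp only [U, hi, Function.update_self]
            refine ⟨fun x _ => by split_ifs <;> norm_num, ?_⟩
            rw [sum_ite_eq', if_pos ha]
          · simp only [U, Function.update_of_ne hi]
            exact ht h hh
        · by_cases hi : G.info h = G.info h₀
          · simp only [U, hi, Function.update_self]
            split_ifs
            · exact Or.inr rfl
            · exact Or.inl rfl
          · simp only [U, Function.update_of_ne hi]
            exact htF h hh ((mem_insert.1 hF).resolve_left hi) a' ha'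
      · refine ⟨t, ht, fun h hh hF => ?_, hst⟩
        exact htF h hh ((mem_insert.1 hF).resolve_left fun he => hj ⟨h, hh, he⟩)
  obtain ⟨t, ht, htF, hst⟩ := key (G.nodes.image G.info)
  refine ⟨t, ⟨ht, fun h hd => htF h hd (mem_image_of_mem _ ?_)⟩, hst⟩
  obtain ⟨a, ha⟩ := hd.1
  exact G.parent_mem a h ha

/-- **Kuhn's theorem**: under perfect recall, a mixture of strategies has the reach
probabilities of some behavior strategy, namely of the conditional probabilities of the actions. -/
theorem PerfectRecall.exists_strategy_reach_eq (hG : G.PerfectRecall) {K : Type*} {P : Finset K}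
    {w : K → ℝ} (hw : ∀ m ∈ P, 0 ≤ w m) (hw1 : ∑ m ∈ P, w m = 1) {τ : K → J → A → ℝ}
    (hτ : ∀ m ∈ P, G.IsStrategy i (τ m)) :
    ∃ s, G.IsStrategy i s ∧
      ∀ h ∈ G.nodes, G.reach i s h = ∑ m ∈ P, w m * G.reach i (τ m) h := by
  obtain ⟨m₀, hm₀⟩ : P.Nonempty := by
    rw [nonempty_iff_ne_empty]
    rintro rfl
    simp at hw1
  let r : List A → ℝ := fun h => ∑ m ∈ P, w m * G.reach i (τ m) h
  have hrseq : ∀ h h', G.seq i h = G.seq i h' → r h = r h' := fun h h' he =>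
    sum_congr rfl fun m _ => by rw [reach_eq_of_seq_eq he]
  have hr0 : ∀ h ∈ G.nodes, 0 ≤ r h := fun h hh =>
    sum_nonneg fun m hm => mul_nonneg (hw m hm) (reach_nonneg (hτ m hm) hh)
  let Q : J → List A → Prop := fun j h => G.Decision i h ∧ G.info h = j ∧ 0 < r h
  let s : J → A → ℝ := fun j a =>
    if hj : ∃ h, Q j h then r (a :: hj.choose) / r hj.choose else τ m₀ j a
  have hspos : ∀ h a, G.Decision i h → 0 < r h → s (G.info h) a = r (a :: h) / r h := by
    intro h a hd hr
    have hj : ∃ h', Q (G.info h) h' := ⟨h, hd, rfl, hr⟩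
    obtain ⟨hd', hi, -⟩ := hj.choose_spec
    have hseq := hG i _ _ hd' hd hi
    simp only [s, dif_pos hj]
    rw [hrseq _ _ hseq, hrseq (a :: hj.choose) (a :: h)]
    rw [seq_cons_of_eq hd'.2, seq_cons_of_eq hd.2, hi, hseq]
  have hszero : ∀ h a, G.Decision i h → ¬ 0 < r h → s (G.info h) a = τ m₀ (G.info h) a := by
    intro h a hd hr
    refine dif_neg ?_
    rintro ⟨h', hd', hi, hr'⟩
    rw [hrseq _ _ (hG i _ _ hd' hd hi)] at hr'
    exact hr hr'
  have hrsum : ∀ h, G.Decision i h → ∑ a ∈ G.actions h, r (a :: h) = r h := by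
    intro h hd
    simp only [r]
    rw [sum_comm]
    refine sum_congr rfl fun m hm => ?_
    simp only [reach_cons_of_eq hd.2]
    rw [← mul_sum, ← mul_sum, (hτ m hm h hd).2, mul_one]
  refine ⟨s, fun h hd => ?_, fun h hh => ?_⟩
  · by_cases hr : 0 < r h
    · simp only [hspos h _ hd hr]
      refine ⟨fun a ha => div_nonneg (hr0 _ (mem_actions.1 ha)) hr.le, ?_⟩
      rw [← sum_div, hrsum h hd, div_self hr.ne']
    · simp only [hszero h _ hd hr]
      exact hτ m₀ hm₀ h hd
  · change _ = r h
    induction h with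
    | nil => simpa [r, reach] using hw1.symm
    | cons a h ih =>
      have hhn := G.parent_mem a h hh
      have ih' := ih hhn
      by_cases hp : G.player h = some i
      · have hd : G.Decision i h := ⟨⟨a, hh⟩, hp⟩
        rw [reach_cons_of_eq hp, ih']
        by_cases hr : 0 < r h
        · rw [hspos h a hd hr, mul_div_cancel₀ _ hr.ne']
        · have h0 : r h = 0 := le_antisymm (not_lt.1 hr) (hr0 h hhn)
          have h1 := hrsum h hd
          rw [h0, sum_eq_zero_iff_of_nonneg fun a ha => hr0 _ (mem_actions.1 ha)] at h1
          rw [h0, zero_mul, h1 a (mem_actions.2 hh)]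
      · rw [reach_cons_of_ne hp, ih']
        simp only [r, reach_cons_of_ne hp]

theorem natureReach_eq_one (hN : G.NoNature) (hz : z ∈ G.nodes) : G.natureReach z = 1 := by
  induction z with
  | nil => rfl
  | cons a z ih =>
    rw [natureReach, ih (G.parent_mem a z hz), if_neg (hN z ⟨a, hz⟩), one_mul]

theorem length_le_of_mem_nodes {d : ℕ} (hU : G.UniformDepth d) (hh : h ∈ G.nodes) :
    h.length ≤ d := by
  obtain ⟨z, hz, hhz, -⟩ := exists_leaf_of_hereditary (fun _ => True) hh trivial
    (fun h' hint _ => by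
      obtain ⟨a, ha⟩ := hint
      exact ⟨a, ha, trivial⟩)
  rw [← hU z hz]
  exact hhz.length_le

theorem pow_le_card_leaves {b d : ℕ} (hB : G.UniformBranching b) (hU : G.UniformDepth d) :
    b ^ d ≤ G.leaves.card := by
  have hlev : ∀ l ≤ d, b ^ l ≤ (G.nodes.filter fun h => h.length = l).card := by
    intro l
    induction l with
    | zero =>
      intro _
      rw [pow_zero]
      exact card_pos.2 ⟨[], mem_filter.2 ⟨G.root_mem, rfl⟩⟩
    | succ l ih =>
      intro hl
      rw [pow_succ']
      refine (Nat.mul_le_mul_left b (ih (by omega))).trans ?_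
      refine mul_card_image_le_card_of_maps_to (f := List.tail) (fun h hh => ?_) b fun h hh => ?_
      · obtain ⟨hn, hlen⟩ := mem_filter.1 hh
        rcases h with - | ⟨a, h⟩
        · simp at hlen
        · exact mem_filter.2 ⟨G.parent_mem a h hn, by simpa using hlen⟩
      · obtain ⟨hn, hlen⟩ := mem_filter.1 hh
        have hint : G.Internal h := by
          by_contra hint
          have := hU h (mem_leaves.2 ⟨hn, hint⟩)
          omega
        rw [← hB h hint, ← card_image_of_injective (G.actions h)
          (f := fun a => a :: h) fun a a' e => (List.cons.inj e).1]
        refine card_le_card fun z hz => ?_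
        obtain ⟨a, ha, rfl⟩ := mem_image.1 hz
        exact mem_filter.2 ⟨mem_filter.2 ⟨mem_actions.1 ha, by simp [hlen]⟩, rfl⟩
  refine (hlev d le_rfl).trans (card_le_card fun z hz => ?_)
  obtain ⟨hn, hlen⟩ := mem_filter.1 hz
  refine mem_leaves.2 ⟨hn, ?_⟩
  rintro ⟨a, ha⟩
  have := length_le_of_mem_nodes hU ha
  simp only [List.length_cons] at this
  omega

theorem card_actions_le {b : ℕ} (hB : G.UniformBranching b) (h : List A) :
    (G.actions h).card ≤ b := by
  by_cases hint : G.Internal h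
  · exact (hB h hint).le
  · rw [card_eq_zero.2]
    · exact Nat.zero_le _
    · refine eq_empty_of_forall_notMem fun a ha => hint ⟨a, mem_actions.1 ha⟩

theorem card_terminalSeqs_le (hs : G.IsPureStrategy i s) :
    (G.terminalSeqs i s).card ≤ G.maxTerminalSeqs :=
  le_csSup G.bddAbove_terminalSeqs ⟨i, s, hs, rfl⟩

theorem one_le_maxTerminalSeqs (G : GameTree ι A J) (i : ι) : 1 ≤ G.maxTerminalSeqs := by
  obtain ⟨s, hs⟩ := G.exists_isPureStrategy i
  refine le_trans (card_pos.2 ?_) (card_terminalSeqs_le hs)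
  obtain ⟨z, hz, -, hr⟩ := exists_leaf_of_hereditary (fun h => 0 < G.reach i s h) G.root_mem
    one_pos fun h' hint hr => exists_child_reach_pos hs.1 hint hr
  exact ⟨_, mem_image_of_mem _ (mem_filter.2 ⟨hz, hr⟩)⟩

end Basic

end GameTree

end ExtensiveForm

/-! ### Two-player games without nature -/

namespace ExtensiveForm

namespace GameTree

open scoped Classical
open Finset

section TwoPlayers

variable {A J : Type*} {G : GameTree (Fin 2) A J} {i j : Fin 2} {s t : J → A → ℝ} {h z : List A}
  {a : A} {b d : ℕ}

theorem player_eq_or (hN : G.NoNature) (hij : i ≠ j) (hint : G.Internal h) :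
    G.player h = some i ∨ G.player h = some j := by
  have := hN h hint
  rcases hp : G.player h with - | l
  · exact absurd hp this
  · have : l = i ∨ l = j := by omega
    rcases this with rfl | rfl
    · exact Or.inl rfl
    · exact Or.inr rfl

/-- Without nature, a pure strategy of one player and a sequence of the other determine the
leaf. -/
theorem leaf_eq_of_seq_eq (hN : G.NoNature) (hU : G.UniformDepth d) (hij : i ≠ j)
    (ht : G.IsPureStrategy j t) {z z' : List A} (hz : z ∈ G.leaves) (hz' : z' ∈ G.leaves)
    (hr : 0 < G.reach j t z) (hr' : 0 < G.reach j t z') (hs : G.seq i z = G.seq i z') :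
    z = z' := by
  -- compare the paths from the root on: `h` is the part already known to be common
  have key : ∀ (n : ℕ) (u u' h : List A), u.length = n → u'.length = n →
      u ++ h ∈ G.nodes → u' ++ h ∈ G.nodes →
      0 < G.reach j t (u ++ h) → 0 < G.reach j t (u' ++ h) →
      G.seq i (u ++ h) = G.seq i (u' ++ h) → u = u' := by
    intro n
    induction n with
    | zero =>
      intro u u' h hu hu' _ _ _ _ _
      rw [List.length_eq_zero_iff.1 hu, List.length_eq_zero_iff.1 hu']
    | succ n ih =>
      intro u u' h hu hu' hn hn' hr hr' hs
      rcases List.eq_nil_or_concat u with rfl | ⟨v, a, rfl⟩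
      · simp at hu
      rcases List.eq_nil_or_concat u' with rfl | ⟨v', a', rfl⟩
      · simp at hu'
      simp only [List.concat_eq_append, List.append_assoc, List.singleton_append,
        List.length_append, List.length_singleton] at *
      have hsf : a :: h <:+ v ++ a :: h := List.suffix_append _ _
      have hsf' : a' :: h <:+ v' ++ a' :: h := List.suffix_append _ _
      have hc := mem_nodes_of_suffix hn hsf
      have hc' := mem_nodes_of_suffix hn' hsf'
      have haa : a = a' := by
        rcases player_eq_or hN hij ⟨a, hc⟩ with hp | hp
        · have h1 := seq_suffix_seq (G := G) (i := i) hsf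
          have h2 := seq_suffix_seq (G := G) (i := i) hsf'
          rw [← hs] at h2
          rw [seq_cons_of_eq hp] at h1 h2
          have h3 := List.suffix_of_suffix_length_le h1 h2 (by simp)
          have h4 := h3.eq_of_length (by simp)
          exact (Prod.mk.inj (List.cons.inj h4).1).2
        · exact ht.eq_of_pos ⟨⟨a, hc⟩, hp⟩ (mem_actions.2 hc) (mem_actions.2 hc')
            (action_pos_of_reach_pos ht.1 hc hp (reach_pos_of_suffix ht.1 hn hr hsf))
            (action_pos_of_reach_pos ht.1 hc' hp (reach_pos_of_suffix ht.1 hn' hr' hsf'))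
      subst haa
      rw [ih v v' (a :: h) (by omega) (by omega) hn hn' hr hr' hs]
  have := key d z z' [] (hU z hz) (hU z' hz')
  simp only [List.append_nil] at this
  exact this (mem_nodes_of_mem_leaves hz) (mem_nodes_of_mem_leaves hz') hr hr' hs

/-- The expectation of `f` if player `i` plays `s`, the opponent `j` plays `t`, and there is no
nature. -/
noncomputable def pay (G : GameTree (Fin 2) A J) (i j : Fin 2) (f : List A → ℝ)
    (s t : J → A → ℝ) : ℝ :=
  ∑ z ∈ G.leaves, G.reach i s z * (G.reach j t z * f z)

/-- The contribution to the expectation of `f` of the leaves at which player `i` has the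
sequence `q`, if player `i` plays towards them and the opponent `j` plays `t`. -/
noncomputable def seqPay (G : GameTree (Fin 2) A J) (i j : Fin 2) (f : List A → ℝ)
    (q : List (J × A)) (t : J → A → ℝ) : ℝ :=
  ∑ z ∈ G.leaves.filter fun z => G.seq i z = q, G.reach j t z * f z

theorem pay_comm {f : List A → ℝ} : G.pay i j f s t = G.pay j i f t s :=
  sum_congr rfl fun z _ => by ring

theorem pay_eq_sum_seqPay {f : List A → ℝ} (hs : G.IsPureStrategy i s) :
    G.pay i j f s t = ∑ q ∈ G.terminalSeqs i s, G.seqPay i j f q t := by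
  have h1 : G.pay i j f s t =
      ∑ z ∈ G.leaves.filter fun z => 0 < G.reach i s z, G.reach j t z * f z := by
    rw [sum_filter]
    refine sum_congr rfl fun z hz => ?_
    rcases reach_eq_zero_or_one hs (mem_nodes_of_mem_leaves hz) with h0 | h1
    · rw [h0, zero_mul, if_neg (lt_irrefl _)]
    · rw [h1, one_mul, if_pos one_pos]
  rw [h1, terminalSeqs, ← sum_fiberwise_of_maps_to (g := G.seq i)
    (fun z hz => mem_image_of_mem _ hz)]
  refine sum_congr rfl fun q hq => ?_
  obtain ⟨z₀, hz₀, rfl⟩ := mem_image.1 hq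
  rw [seqPay, filter_filter]
  refine sum_congr (filter_congr fun z _ => ?_) fun _ _ => rfl
  refine ⟨fun hz => hz.2, fun hz => ⟨?_, hz⟩⟩
  rw [reach_eq_of_seq_eq hz]
  exact (mem_filter.1 hz₀).2

theorem abs_seqPay_le (hN : G.NoNature) (hU : G.UniformDepth d) (hij : i ≠ j)
    (ht : G.IsPureStrategy j t) {f : List A → ℝ} {M : ℝ} (hM : 0 ≤ M)
    (hf : ∀ z ∈ G.leaves, |f z| ≤ M) (q : List (J × A)) : |G.seqPay i j f q t| ≤ M := by
  by_cases hex : ∃ z₀ ∈ G.leaves.filter fun z => G.seq i z = q, 0 < G.reach j t z₀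
  · obtain ⟨z₀, hz₀, hr₀⟩ := hex
    obtain ⟨hz₀l, rfl⟩ := mem_filter.1 hz₀
    rw [seqPay, sum_eq_single_of_mem z₀ hz₀]
    · rw [(reach_eq_zero_or_one ht (mem_nodes_of_mem_leaves hz₀l)).resolve_left hr₀.ne', one_mul]
      exact hf z₀ hz₀l
    · intro z hz hne
      obtain ⟨hzl, hzs⟩ := mem_filter.1 hz
      rcases reach_eq_zero_or_one ht (mem_nodes_of_mem_leaves hzl) with h0 | h1
      · rw [h0, zero_mul]
      · exact absurd (leaf_eq_of_seq_eq hN hU hij ht hzl hz₀l (by rw [h1]; exact one_pos) hr₀ hzs)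
          hne
  · push Not at hex
    rw [seqPay, sum_eq_zero, abs_zero]
    · exact hM
    · intro z hz
      rw [le_antisymm (hex z hz) (reach_nonneg ht.1 (mem_nodes_of_mem_leaves (mem_filter.1 hz).1)),
        zero_mul]

theorem pay_mixture {K : Type*} {P : Finset K} {w : K → ℝ} {τ : K → J → A → ℝ}
    (ht : ∀ h ∈ G.nodes, G.reach j t h = ∑ m ∈ P, w m * G.reach j (τ m) h) (f : List A → ℝ) :
    G.pay i j f s t = ∑ m ∈ P, w m * G.pay i j f s (τ m) := by
  simp only [pay, mul_sum]
  rw [sum_comm]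
  refine sum_congr rfl fun z hz => ?_
  rw [ht z (mem_nodes_of_mem_leaves hz), sum_mul, mul_sum]
  exact sum_congr rfl fun m _ => by ring

theorem pay_congr_left (hst : ∀ z ∈ G.nodes, G.reach i s z = G.reach i t z) {u : J → A → ℝ}
    (f : List A → ℝ) : G.pay i j f s u = G.pay i j f t u :=
  sum_congr rfl fun z hz => by rw [hst z (mem_nodes_of_mem_leaves hz)]

theorem value_eq_pay (hN : G.NoNature) (hij : i ≠ j) (f : List A → ℝ) (σ : Fin 2 → J → A → ℝ) :
    G.value f σ = G.pay i j f (σ i) (σ j) := by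
  refine sum_congr rfl fun z hz => ?_
  rw [natureReach_eq_one hN (mem_nodes_of_mem_leaves hz), one_mul, Fin.prod_univ_two]
  have : (i = 0 ∧ j = 1) ∨ (i = 1 ∧ j = 0) := by omega
  rcases this with ⟨rfl, rfl⟩ | ⟨rfl, rfl⟩ <;> ring

/-- The nodes of depth `l` that are reached if player `i` plays `s` and the opponent plays
towards them. -/
noncomputable def reachedAt (G : GameTree (Fin 2) A J) (i : Fin 2) (s : J → A → ℝ) (l : ℕ) :
    Finset (List A) :=
  G.nodes.filter fun h => h.length = l ∧ 0 < G.reach i s h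

/-- As the moves alternate, a pure strategy leaves `b` possibilities for every two moves. -/
theorem card_reachedAt_add_two_le (hN : G.NoNature) (hB : G.UniformBranching b)
    (hA : G.Alternating) (hs : G.IsPureStrategy i s) (l : ℕ) :
    (G.reachedAt i s (l + 2)).card ≤ b * (G.reachedAt i s l).card := by
  refine card_le_mul_card_image_of_maps_to (f := fun z => z.tail.tail) (fun z hz => ?_) b
    fun h _ => ?_
  · obtain ⟨hn, hlen, hr⟩ := mem_filter.1 hz
    rcases z with - | ⟨a', - | ⟨a, h⟩⟩
    · simp at hlen
    · simp at hlen
    · have hn' := G.parent_mem _ _ hn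
      exact mem_filter.2 ⟨G.parent_mem _ _ hn', by simpa using hlen,
        reach_pos_of_cons hs.1 hn' (reach_pos_of_cons hs.1 hn hr)⟩
  · have hform : ∀ z ∈ (G.reachedAt i s (l + 2)).filter fun z => z.tail.tail = h,
        ∃ a a', z = a' :: a :: h ∧ z ∈ G.nodes ∧ 0 < G.reach i s z := by
      intro z hz
      obtain ⟨hz, hzh⟩ := mem_filter.1 hz
      obtain ⟨hn, hlen, hr⟩ := mem_filter.1 hz
      rcases z with - | ⟨a', - | ⟨a, h'⟩⟩
      · simp at hlen
      · simp at hlen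
      · simp only [List.tail_cons] at hzh
        subst hzh
        exact ⟨a, a', rfl, hn, hr⟩
    by_cases hp : G.player h = some i
    -- the action of player `i` at `h` is forced, and the opponent moves at the next node
    · by_cases hex : ∃ a, a :: h ∈ G.nodes ∧ 0 < G.reach i s (a :: h)
      · obtain ⟨a₀, ha₀, hr₀⟩ := hex
        refine le_trans (card_le_card (t := (G.actions (a₀ :: h)).image fun a' => a' :: a₀ :: h)
          fun z hz => ?_) (card_image_le.trans (card_actions_le hB _))
        obtain ⟨a, a', rfl, hn, hr⟩ := hform z hz
        have hn' := G.parent_mem _ _ hn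
        have haa : a = a₀ := hs.eq_of_pos ⟨⟨a, hn'⟩, hp⟩ (mem_actions.2 hn') (mem_actions.2 ha₀)
          (action_pos_of_reach_pos hs.1 hn' hp (reach_pos_of_cons hs.1 hn hr))
          (action_pos_of_reach_pos hs.1 ha₀ hp hr₀)
        subst haa
        exact mem_image_of_mem _ (mem_actions.2 hn)
      · rw [card_eq_zero.2]
        · exact Nat.zero_le _
        · refine eq_empty_of_forall_notMem fun z hz => hex ?_
          obtain ⟨a, a', rfl, hn, hr⟩ := hform z hz
          exact ⟨a, G.parent_mem _ _ hn, reach_pos_of_cons hs.1 hn hr⟩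
    -- the opponent moves at `h` and player `i` at its children, where the action is forced
    · let g : A → A := fun a =>
        if H : ∃ a', a' :: a :: h ∈ G.nodes ∧ 0 < s (G.info (a :: h)) a' then H.choose else a
      refine le_trans (card_le_card (t := (G.actions h).image fun a => g a :: a :: h)
          fun z hz => ?_) (card_image_le.trans (card_actions_le hB _))
      obtain ⟨a, a', rfl, hn, hr⟩ := hform z hz
      have hn' := G.parent_mem _ _ hn
      have hp' : G.player (a :: h) = some i := by
        have h1 := hA a h ⟨a', hn⟩
        obtain ⟨j, hij⟩ : ∃ j : Fin 2, i ≠ j := ⟨1 - i, by omega⟩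
        have h2 := (player_eq_or hN hij ⟨a, hn'⟩).resolve_left hp
        rw [h2] at h1
        exact (player_eq_or hN hij ⟨a', hn⟩).resolve_right h1
      have hpos := action_pos_of_reach_pos hs.1 hn hp' hr
      have H : ∃ a', a' :: a :: h ∈ G.nodes ∧ 0 < s (G.info (a :: h)) a' := ⟨a', hn, hpos⟩
      have hg : g a = a' := by
        simp only [g, dif_pos H]
        exact hs.eq_of_pos ⟨⟨a', hn⟩, hp'⟩ (mem_actions.2 H.choose_spec.1) (mem_actions.2 hn)
          H.choose_spec.2 hpos
      rw [← hg]
      exact mem_image_of_mem (fun a => g a :: a :: h) (mem_actions.2 hn')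

theorem card_reachedAt_le (hN : G.NoNature) (hB : G.UniformBranching b)
    (hA : G.Alternating) (hs : G.IsPureStrategy i s) (l : ℕ) :
    (G.reachedAt i s l).card ≤ b ^ ((l + 1) / 2) := by
  induction l using Nat.twoStepInduction with
  | zero =>
    refine card_le_one.2 fun x hx y hy => ?_
    rw [List.length_eq_zero_iff.1 (mem_filter.1 hx).2.1,
      List.length_eq_zero_iff.1 (mem_filter.1 hy).2.1]
  | one =>
    refine le_trans (card_le_card (t := (G.actions []).image fun a => [a]) fun z hz => ?_)
      (card_image_le.trans ?_)
    · obtain ⟨hn, hlen, -⟩ := mem_filter.1 hz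
      obtain ⟨a, rfl⟩ := List.length_eq_one_iff.1 hlen
      exact mem_image_of_mem _ (mem_actions.2 hn)
    · simpa using card_actions_le hB []
  | more l ih _ =>
    refine (card_reachedAt_add_two_le hN hB hA hs l).trans ?_
    rw [show (l + 2 + 1) / 2 = (l + 1) / 2 + 1 by omega, pow_succ']
    exact Nat.mul_le_mul_left b ih

/-- The number of internal nodes in the reach of a pure strategy is of the order of the square root
of the number `b ^ d` of leaves. -/
theorem card_reached_internal_le (hb : 2 ≤ b) (hN : G.NoNature) (hB : G.UniformBranching b)
    (hA : G.Alternating) (hU : G.UniformDepth d) (hs : G.IsPureStrategy i s) :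
    ((G.nodes.filter fun h => G.Internal h ∧ 0 < G.reach i s h).card : ℝ) ≤
      √b / (√b - 1) * √(G.leaves.card) := by
  have hx : 1 < √(b : ℝ) := by
    rw [Real.lt_sqrt zero_le_one]
    have : (2 : ℝ) ≤ b := by exact_mod_cast hb
    linarith
  have hsub : (G.nodes.filter fun h => G.Internal h ∧ 0 < G.reach i s h) ⊆
      (range d).biUnion (G.reachedAt i s) := by
    intro h hh
    obtain ⟨hn, ⟨a, ha⟩, hr⟩ := mem_filter.1 hh
    refine mem_biUnion.2 ⟨h.length, mem_range.2 ?_, mem_filter.2 ⟨hn, rfl, hr⟩⟩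
    have := length_le_of_mem_nodes hU ha
    simpa using this
  have h1 : ((G.nodes.filter fun h => G.Internal h ∧ 0 < G.reach i s h).card : ℝ) ≤
      ∑ l ∈ range d, √(b : ℝ) ^ (l + 1) := by
    refine le_trans (Nat.cast_le.2 ((card_le_card hsub).trans card_biUnion_le)) ?_
    rw [Nat.cast_sum]
    refine sum_le_sum fun l _ => ?_
    refine le_trans (Nat.cast_le.2 (card_reachedAt_le hN hB hA hs l)) ?_
    rw [Nat.cast_pow]
    calc (b : ℝ) ^ ((l + 1) / 2) = √(b : ℝ) ^ (2 * ((l + 1) / 2)) := by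
          rw [pow_mul, Real.sq_sqrt (Nat.cast_nonneg b)]
      _ ≤ _ := pow_le_pow_right₀ hx.le (by omega)
  have h2 : √(b : ℝ) ^ d ≤ √(G.leaves.card) := by
    refine Real.le_sqrt_of_sq_le ?_
    rw [← pow_mul, mul_comm d 2, pow_mul, Real.sq_sqrt (Nat.cast_nonneg b)]
    exact_mod_cast pow_le_card_leaves hB hU
  refine h1.trans ?_
  have hx0 : 0 < √(b : ℝ) - 1 := by linarith
  simp only [pow_succ]
  rw [← sum_mul, geom_sum_eq hx.ne', div_mul_eq_mul_div, div_mul_eq_mul_div]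
  refine div_le_div_of_nonneg_right ?_ hx0.le
  nlinarith

/-- The accuracy on the sequences of the pure strategy `s` carries over to its payoff. -/
theorem abs_sum_pay_sub_le {P : Finset (J → A → ℝ)} {w : (J → A → ℝ) → ℝ} {τ : ℕ → J → A → ℝ}
    {k : ℕ} {f : List A → ℝ} {δ : ℝ} (hδ : 0 ≤ δ) (hs : G.IsPureStrategy i s)
    (hτ : ∀ q ∈ G.leaves.image (G.seq i),
      |∑ m ∈ range k, G.seqPay i j f q (τ m) - k * ∑ t ∈ P, w t * G.seqPay i j f q t| ≤ k * δ) :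
    |∑ m ∈ range k, G.pay i j f s (τ m) - k * ∑ t ∈ P, w t * G.pay i j f s t| ≤
      k * (G.maxTerminalSeqs * δ) := by
  have h1 : ∑ m ∈ range k, G.pay i j f s (τ m) - k * ∑ t ∈ P, w t * G.pay i j f s t =
      ∑ q ∈ G.terminalSeqs i s, (∑ m ∈ range k, G.seqPay i j f q (τ m) -
        k * ∑ t ∈ P, w t * G.seqPay i j f q t) := by
    simp only [pay_eq_sum_seqPay hs, mul_sum, sum_sub_distrib]
    rw [sum_comm]
    congr 1
    rw [sum_comm]
  rw [h1]
  refine (abs_sum_le_sum_abs _ _).trans ?_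
  calc _ ≤ ∑ q ∈ G.terminalSeqs i s, (k * δ) := sum_le_sum fun q hq => hτ q (by
        obtain ⟨z, hz, rfl⟩ := mem_image.1 hq
        exact mem_image_of_mem _ (mem_filter.1 hz).1)
    _ = (G.terminalSeqs i s).card * (k * δ) := by rw [sum_const, nsmul_eq_mul]
    _ ≤ G.maxTerminalSeqs * (k * δ) := by
        refine mul_le_mul_of_nonneg_right ?_ (by positivity)
        exact_mod_cast card_terminalSeqs_le hs
    _ = _ := by ring

end TwoPlayers

end GameTree

end ExtensiveForm

namespace ExtensiveForm

open scoped Classical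
open Finset

/-! ### Trunks -/

section Trunk

variable {ι A J : Type*}

/-- The trunk of `G` whose internal nodes are the internal nodes of `G` with the property `Φ`
(which has to pass on to parents).  The bounds on the utilities are trivial at the collapsed
nodes and exact at the leaves of `G`. -/
noncomputable def Game.trunk (G : Game ι A J) (Φ : List A → Prop)
    (hΦ : ∀ a h, a :: h ∈ G.nodes → Φ (a :: h) → Φ h) {M : ℝ} (hM : 0 ≤ M) :
    Pseudogame ι A J where
  nodes := G.nodes.filter fun h => h = [] ∨ Φ h.tail
  root_mem := mem_filter.2 ⟨G.root_mem, Or.inl rfl⟩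
  parent_mem a h hh := by
    obtain ⟨hn, hp⟩ := mem_filter.1 hh
    have hp' : Φ h := hp.resolve_left (List.cons_ne_nil a h)
    refine mem_filter.2 ⟨G.parent_mem a h hn, ?_⟩
    rcases h with - | ⟨a', h⟩
    · exact Or.inl rfl
    · exact Or.inr (hΦ a' h (G.parent_mem a _ hn) hp')
  player := G.player
  info := G.info
  chance := G.chance
  same_actions i h h' := by
    rintro ⟨x, hx⟩ ⟨x', hx'⟩ hp hp' hi a
    simp only [mem_filter, List.cons_ne_nil, false_or, List.tail_cons] at *
    have := G.same_actions i h h' ⟨x, hx.1⟩ ⟨x', hx'.1⟩ hp hp' hi a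
    exact ⟨fun h1 => ⟨this.1 h1.1, hx'.2⟩, fun h1 => ⟨this.2 h1.1, hx.2⟩⟩
  chance_nonneg h a hp ha := G.chance_nonneg h a hp (mem_filter.1 ha).1
  chance_sum h := by
    rintro ⟨x, hx⟩ hp
    have hx' := mem_filter.1 hx
    rw [← G.chance_sum h ⟨x, hx'.1⟩ hp]
    refine sum_congr ?_ fun _ _ => rfl
    ext a
    simp only [mem_preimage, mem_filter]
    exact ⟨fun ha => ha.1, fun ha => ⟨ha, Or.inr (hx'.2.resolve_left (List.cons_ne_nil x h))⟩⟩
  lower i h := if h ∈ G.leaves then G.util i h else -M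
  upper i h := if h ∈ G.leaves then G.util i h else M
  lower_le_upper i z _ := by
    by_cases hz : z ∈ G.leaves
    · rw [if_pos hz, if_pos hz]
    · rw [if_neg hz, if_neg hz]; linarith

variable {G : Game ι A J} {Φ : List A → Prop} {hΦ : ∀ a h, a :: h ∈ G.nodes → Φ (a :: h) → Φ h}
  {M : ℝ} {hM : 0 ≤ M} {h : List A} {a : A}

theorem cons_mem_trunk_nodes : a :: h ∈ (G.trunk Φ hΦ hM).nodes ↔ a :: h ∈ G.nodes ∧ Φ h := by
  refine mem_filter.trans (and_congr_right fun _ => ?_)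
  simp

theorem trunk_nodes_subset : (G.trunk Φ hΦ hM).nodes ⊆ G.nodes := filter_subset _ _

theorem trunk_internal : (G.trunk Φ hΦ hM).Internal h ↔ G.Internal h ∧ Φ h := by
  constructor
  · rintro ⟨a, ha⟩
    obtain ⟨h1, h2⟩ := cons_mem_trunk_nodes.1 ha
    exact ⟨⟨a, h1⟩, h2⟩
  · rintro ⟨⟨a, ha⟩, h2⟩
    exact ⟨a, cons_mem_trunk_nodes.2 ⟨ha, h2⟩⟩

theorem trunk_actions (hh : Φ h) : (G.trunk Φ hΦ hM).actions h = G.actions h := by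
  ext a
  rw [GameTree.mem_actions, GameTree.mem_actions, cons_mem_trunk_nodes, and_iff_left hh]

theorem isTrunk_trunk (hu : ∀ i, ∀ z ∈ G.leaves, |G.util i z| ≤ M) :
    IsTrunk (G.trunk Φ hΦ hM) G where
  nodes_subset := trunk_nodes_subset
  children h hh a ha := cons_mem_trunk_nodes.2 ⟨ha, (trunk_internal.1 hh).2⟩
  player_eq _ _ := rfl
  info_eq _ _ := rfl
  chance_eq _ _ _ _ _ := rfl
  bounds h _ z hz hhz i := by
    by_cases hh : h ∈ G.leaves
    · rw [GameTree.eq_of_leaf_suffix hh (GameTree.mem_nodes_of_mem_leaves hz) hhz]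
      simp [Game.trunk, hh]
    · simp only [Game.trunk, if_neg hh]
      exact abs_le.1 (hu i z hz)

theorem trunk_reach (i : ι) (s : J → A → ℝ) (h : List A) :
    (G.trunk Φ hΦ hM).reach i s h = G.reach i s h := by
  induction h with
  | nil => rfl
  | cons a h ih =>
    rw [GameTree.reach, GameTree.reach, ih]
    rfl

theorem trunk_isStrategy {i : ι} {s : J → A → ℝ} (hs : G.IsStrategy i s) :
    (G.trunk Φ hΦ hM).IsStrategy i s := by
  intro h hd
  obtain ⟨hint, hh⟩ := trunk_internal.1 hd.1
  rw [trunk_actions hh]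
  exact hs h ⟨hint, hd.2⟩

/-- A strategy in the trunk extends to the whole game. -/
theorem exists_isStrategy_reach_eq_trunk {i : ι} {s : J → A → ℝ}
    (hs : (G.trunk Φ hΦ hM).IsStrategy i s) : ∃ s', G.IsStrategy i s' ∧
      ∀ h ∈ (G.trunk Φ hΦ hM).nodes, G.reach i s h = G.reach i s' h := by
  obtain ⟨t, ht⟩ := G.exists_isPureStrategy i
  let s' : J → A → ℝ := fun j =>
    if ∃ h, (G.trunk Φ hΦ hM).Decision i h ∧ G.info h = j then s j else t j
  refine ⟨s', fun h hd => ?_, fun h hh => GameTree.reach_congr fun h' a hsuf hp => ?_⟩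
  · by_cases hex : ∃ h', (G.trunk Φ hΦ hM).Decision i h' ∧ G.info h' = G.info h
    · simp only [s', if_pos hex]
      obtain ⟨h', hd', hi⟩ := hex
      obtain ⟨hint, hh'⟩ := trunk_internal.1 hd'.1
      have h1 := hs h' hd'
      rw [trunk_actions hh', GameTree.actions_eq_of_info_eq ⟨hint, hd'.2⟩ hd hi] at h1
      rw [← hi]
      exact h1
    · simp only [s', if_neg hex]
      exact ht.1 h hd
  · have hex : ∃ h, (G.trunk Φ hΦ hM).Decision i h ∧ G.info h = G.info h' :=
      ⟨h', ⟨⟨a, GameTree.mem_nodes_of_suffix hh hsuf⟩, hp⟩, rfl⟩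
    simp only [s', if_pos hex]

theorem card_trunk_nodes_le {b : ℕ} (hB : G.UniformBranching b) :
    (G.trunk Φ hΦ hM).nodes.card ≤
      1 + b * (G.nodes.filter fun h => G.Internal h ∧ Φ h).card := by
  rw [← card_erase_add_one (G.trunk Φ hΦ hM).root_mem, add_comm]
  refine Nat.add_le_add_left (card_le_mul_card_image_of_maps_to (f := List.tail)
    (fun z hz => ?_) b fun h _ => ?_) 1
  · obtain ⟨hne, hn⟩ := mem_erase.1 hz
    rcases z with - | ⟨a, h⟩
    · exact absurd rfl hne
    · obtain ⟨h1, h2⟩ := cons_mem_trunk_nodes.1 hn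
      exact mem_filter.2 ⟨G.parent_mem a h h1, ⟨a, h1⟩, h2⟩
  · refine le_trans (card_le_card (t := (G.actions h).image fun a => a :: h) fun z hz => ?_)
      (card_image_le.trans (GameTree.card_actions_le hB h))
    obtain ⟨hz, hzh⟩ := mem_filter.1 hz
    obtain ⟨hne, hn⟩ := mem_erase.1 hz
    rcases z with - | ⟨a, h'⟩
    · exact absurd rfl hne
    · simp only [List.tail_cons] at hzh
      subst hzh
      exact mem_image_of_mem _ (GameTree.mem_actions.2 (cons_mem_trunk_nodes.1 hn).1)

end Trunk

/-! ### Certificates from sampled strategies -/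

section TwoPlayers

variable {A J : Type*} {G : Game (Fin 2) A J} {i j : Fin 2} {Φ : List A → Prop}
  {hΦ : ∀ a h, a :: h ∈ G.nodes → Φ (a :: h) → Φ h} {M : ℝ} {hM : 0 ≤ M}

/-- If the trunk contains the whole reach of the strategy of player `j`, then only leaves of `G` are
reached in it, whatever the opponent does. -/
theorem value_trunk (hN : G.NoNature) (hij : i ≠ j) {σ : Fin 2 → J → A → ℝ}
    (hσ : G.IsStrategy j (σ j)) (hreach : ∀ h ∈ G.nodes, 0 < G.reach j (σ j) h → Φ h)
    {f g : List A → ℝ} (hfg : ∀ z ∈ G.leaves, f z = g z) :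
    (G.trunk Φ hΦ hM).value f σ = G.pay i j g (σ i) (σ j) := by
  have hNT : (G.trunk Φ hΦ hM).NoNature := fun h hh => hN h (trunk_internal.1 hh).1
  have hzero : ∀ h ∈ G.nodes, ¬ Φ h → G.reach j (σ j) h = 0 := fun h hh hΦh =>
    le_antisymm (not_lt.1 fun hr => hΦh (hreach h hh hr)) (GameTree.reach_nonneg hσ hh)
  rw [GameTree.value_eq_pay hNT hij, GameTree.pay, GameTree.pay]
  simp only [trunk_reach]
  rw [← sum_subset (inter_subset_left : (G.trunk Φ hΦ hM).leaves ∩ G.leaves ⊆ _),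
    ← sum_subset (inter_subset_right : (G.trunk Φ hΦ hM).leaves ∩ G.leaves ⊆ _)]
  · exact sum_congr rfl fun z hz => by rw [hfg z (mem_inter.1 hz).2]
  · intro z hz hz'
    have hzn := GameTree.mem_nodes_of_mem_leaves hz
    have hzT : z ∉ (G.trunk Φ hΦ hM).nodes := fun h => hz' (mem_inter.2 ⟨GameTree.mem_leaves.2
      ⟨h, fun hint => GameTree.not_internal_of_mem_leaves hz (trunk_internal.1 hint).1⟩, hz⟩)
    have h0 : G.reach j (σ j) z = 0 := by
      rcases z with - | ⟨a, h⟩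
      · exact absurd (G.trunk Φ hΦ hM).root_mem hzT
      · have hΦh : ¬ Φ h := fun hΦh => hzT (cons_mem_trunk_nodes.2 ⟨hzn, hΦh⟩)
        rw [GameTree.reach, hzero h (G.parent_mem a h hzn) hΦh, zero_mul]
    rw [h0, zero_mul, mul_zero]
  · intro z hz hz'
    have hzn := trunk_nodes_subset (GameTree.mem_nodes_of_mem_leaves hz)
    have hΦz : ¬ Φ z := fun hΦz => by
      have hint : ¬ G.Internal z := fun hint =>
        GameTree.not_internal_of_mem_leaves hz (trunk_internal.2 ⟨hint, hΦz⟩)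
      exact hz' (mem_inter.2 ⟨hz, GameTree.mem_leaves.2 ⟨hzn, hint⟩⟩)
    rw [hzero z hzn hΦz, zero_mul, mul_zero]

/-- An approximate equilibrium `(p, q)` in mixed strategies is approximated by behavior strategies
`σ`, `ρ`, in the sense that each has almost the payoffs of `p` or `q` against all pure strategies.
Then `σ` is nearly a best response to `ρ`. -/
theorem pay_sub_pay_le (hG : G.PerfectRecall) {P Q : Finset (J → A → ℝ)}
    {p q : (J → A → ℝ) → ℝ} {σ ρ : J → A → ℝ} {f : List A → ℝ} {α η : ℝ}
    (hrep : ∀ t, G.IsPureStrategy i t → ∃ s ∈ P, ∀ h ∈ G.nodes, G.reach i t h = G.reach i s h)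
    (hP : ∀ s ∈ P, G.IsPureStrategy i s)
    (hQ : ∀ t ∈ Q, G.IsPureStrategy j t) (hq : ∀ t ∈ Q, 0 ≤ q t) (hq1 : ∑ t ∈ Q, q t = 1)
    (hnash : ∀ s' ∈ P, ∑ t ∈ Q, q t * G.pay i j f s' t ≤
      ∑ s ∈ P, p s * ∑ t ∈ Q, q t * G.pay i j f s t + η)
    (hσ : G.IsStrategy i σ)
    (hσp : ∀ t, G.IsPureStrategy j t → |G.pay j i f t σ - ∑ s ∈ P, p s * G.pay j i f t s| ≤ α)
    (hρq : ∀ s, G.IsPureStrategy i s → |G.pay i j f s ρ - ∑ t ∈ Q, q t * G.pay i j f s t| ≤ α)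
    {s' : J → A → ℝ} (hs' : G.IsStrategy i s') :
    G.pay i j f s' ρ - G.pay i j f σ ρ ≤ η + 3 * α := by
  have hdev : G.pay i j f s' ρ ≤ ∑ s ∈ P, p s * ∑ t ∈ Q, q t * G.pay i j f s t + η + α := by
    obtain ⟨t, ht, hle⟩ := hG.exists_pure_le hs' fun z => G.reach j ρ z * f z
    obtain ⟨s, hs, hts⟩ := hrep t ht
    have h1 : G.pay i j f s' ρ ≤ G.pay i j f s ρ :=
      hle.trans_eq (GameTree.pay_congr_left hts f)
    have h2 := (abs_le.1 (hρq s (hP s hs))).2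
    have h3 := hnash s hs
    linarith
  -- the accuracy of `ρ` extends from pure strategies to `σ`, as the difference is linear in the
  -- reach probabilities
  have hval : ∑ t ∈ Q, q t * G.pay i j f σ t - α ≤ G.pay i j f σ ρ := by
    obtain ⟨t, ht, hle⟩ := hG.exists_pure_le hσ fun z =>
      (∑ t' ∈ Q, q t' * G.reach j t' z) * f z - G.reach j ρ z * f z
    have hexp : ∀ s, ∑ z ∈ G.leaves, G.reach i s z *
        ((∑ t' ∈ Q, q t' * G.reach j t' z) * f z - G.reach j ρ z * f z) =
        ∑ t' ∈ Q, q t' * G.pay i j f s t' - G.pay i j f s ρ := by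
      intro s
      simp only [mul_sub, sum_sub_distrib, GameTree.pay, mul_sum, sum_mul]
      rw [sum_comm]
      congr 1
      exact sum_congr rfl fun t' _ => sum_congr rfl fun z _ => by ring
    rw [hexp, hexp] at hle
    have h2 := (abs_le.1 (hρq t ht)).1
    linarith
  have hmix : ∑ s ∈ P, p s * ∑ t ∈ Q, q t * G.pay i j f s t - α ≤
      ∑ t ∈ Q, q t * G.pay i j f σ t := by
    calc ∑ s ∈ P, p s * ∑ t ∈ Q, q t * G.pay i j f s t - α
        = ∑ t ∈ Q, q t * (∑ s ∈ P, p s * G.pay j i f t s - α) := by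
          simp only [mul_sub, sum_sub_distrib, ← sum_mul, hq1, one_mul, mul_sum]
          rw [sum_comm]
          congr 1
          refine sum_congr rfl fun t _ => sum_congr rfl fun s _ => ?_
          rw [GameTree.pay_comm (G := G.toGameTree) (i := i)]
          ring
      _ ≤ _ := sum_le_sum fun t ht => mul_le_mul_of_nonneg_left (by
          have := (abs_le.1 (hσp t (hQ t ht))).1
          rw [GameTree.pay_comm (G := G.toGameTree) (i := i)]
          linarith) (hq t ht)
  linarith

/-- If `k` is large, a sample of `k` pure strategies of player `j` from a distribution `w` yields
a behavior strategy that is carried by the reach of the sample and has almost the payoffs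
of `w`, for both players, against all pure strategies of the opponent. -/
theorem exists_sampled_strategy {d : ℕ} (hG : G.PerfectRecall) (hN : G.NoNature)
    (hU : G.UniformDepth d) (hij : i ≠ j) {P : Finset (J → A → ℝ)} {w : (J → A → ℝ) → ℝ}
    (hP : ∀ s ∈ P, G.IsPureStrategy j s) (hw : ∀ s ∈ P, 0 ≤ w s) (hw1 : ∑ s ∈ P, w s = 1)
    {c : ℝ} (hc : 0 < c) (hu : ∀ l, ∀ z ∈ G.leaves, |G.util l z| ≤ c) {δ : ℝ} (hδ : 0 < δ) {k : ℕ}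
    (hk : 8 * c ^ 2 * Real.log (4 * G.leaves.card) ≤ k * δ ^ 2) (hk0 : 0 < k) :
    ∃ (τ : ℕ → J → A → ℝ) (σ : J → A → ℝ), (∀ m, G.IsPureStrategy j (τ m)) ∧
      G.IsStrategy j σ ∧
      (∀ h ∈ G.nodes, 0 < G.reach j σ h → ∃ m ∈ range k, 0 < G.reach j (τ m) h) ∧
      ∀ l s, G.IsPureStrategy i s →
        |G.pay i j (G.util l) s σ - ∑ t ∈ P, w t * G.pay i j (G.util l) s t| ≤
          G.maxTerminalSeqs * δ := by
  -- one function for each sequence of player `i` at a leaf and each of the two utilities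
  let Q : Finset (List (J × A) × Fin 2) := G.leaves.image (G.seq i) ×ˢ univ
  have hQ : Q.card ≤ 2 * G.leaves.card := by
    rw [card_product, card_univ, Fintype.card_fin, mul_comm]
    exact Nat.mul_le_mul_left 2 card_image_le
  have hQpos : 0 < Q.card := by
    obtain ⟨z, hz, -⟩ := GameTree.exists_leaf_of_hereditary (fun _ => True) G.root_mem trivial
      fun h' hint _ => hint.imp fun a ha => ⟨ha, trivial⟩
    exact card_pos.2 ⟨(G.seq i z, 0), mem_product.2 ⟨mem_image_of_mem _ hz, mem_univ _⟩⟩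
  obtain ⟨τ, hτP, hτ⟩ := exists_samples_abs_sub_le hw hw1 Q
    (f := fun x t => G.seqPay i j (G.util x.2) x.1 t) hc
    (fun x _ t ht => GameTree.abs_seqPay_le hN hU hij (hP t ht) hc.le (hu x.2) x.1) hδ (k := k)
    (by
      refine le_trans (mul_le_mul_of_nonneg_left (Real.log_le_log ?_ ?_) (by positivity)) hk
      · have : (0 : ℝ) < Q.card := Nat.cast_pos.2 hQpos
        positivity
      · have : (Q.card : ℝ) ≤ 2 * G.leaves.card := by exact_mod_cast hQ
        linarith)
  have hk' : (0 : ℝ) < k := Nat.cast_pos.2 hk0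
  obtain ⟨σ, hσ, hσr⟩ := hG.exists_strategy_reach_eq (P := range k) (w := fun _ => 1 / (k : ℝ))
    (fun _ _ => by positivity) (by
      rw [sum_const, card_range, nsmul_eq_mul, mul_one_div_cancel hk'.ne'])
    (fun m _ => (hP (τ m) (hτP m)).1)
  refine ⟨τ, σ, fun m => hP _ (hτP m), hσ, fun h hh hr => ?_, fun l s hs => ?_⟩
  · by_contra! hcon
    rw [hσr h hh] at hr
    refine absurd hr (not_lt.2 (sum_nonpos fun m hm => ?_))
    exact mul_nonpos_of_nonneg_of_nonpos (by positivity) (hcon m hm)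
  · have h1 := GameTree.abs_sum_pay_sub_le (j := j) (w := w) (P := P) (τ := τ) (f := G.util l)
      hδ.le hs (fun q hq => hτ (q, l) (mem_product.2 ⟨hq, mem_univ _⟩))
    rw [GameTree.pay_mixture hσr, ← mul_sum]
    have h2 : 1 / (k : ℝ) * ∑ m ∈ range k, G.pay i j (G.util l) s (τ m) -
        ∑ t ∈ P, w t * G.pay i j (G.util l) s t =
        (∑ m ∈ range k, G.pay i j (G.util l) s (τ m) -
          k * ∑ t ∈ P, w t * G.pay i j (G.util l) s t) / k := by
      field_simp
    rw [h2, abs_div, abs_of_pos hk', div_le_iff₀ hk']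
    exact h1.trans_eq (mul_comm _ _)

/-- A certificate from `k` sampled pure strategies of each player. -/
theorem exists_certificate_of_sample_size {b d : ℕ} (hb : 2 ≤ b) (hG : G.PerfectRecall)
    {c : ℝ} (hc : 0 < c) (hu : ∀ l, ∀ z ∈ G.leaves, |G.util l z| ≤ c) (hN : G.NoNature)
    (hB : G.UniformBranching b) (hA : G.Alternating) (hU : G.UniformDepth d)
    {ε : ℝ} (hε : 0 < ε) {k : ℕ} (hk0 : 0 < k)
    (hk : 8 * c ^ 2 * Real.log (4 * G.leaves.card) ≤ k * (ε / (4 * G.maxTerminalSeqs)) ^ 2) :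
    ∃ (T : Pseudogame (Fin 2) A J) (σ : Fin 2 → J → A → ℝ), IsCertificate G ε T σ ∧
      (T.nodes.card : ℝ) ≤ 1 + b * (2 * k * (√b / (√b - 1) * √(G.leaves.card))) := by
  have hD : (0 : ℝ) < G.maxTerminalSeqs := Nat.cast_pos.2 (G.one_le_maxTerminalSeqs 0)
  choose P hPne hPpure hPrep using fun i => G.exists_finset_pureStrategies i
  obtain ⟨w, hw, hw1, hnash⟩ : ∃ w : Fin 2 → (J → A → ℝ) → ℝ, (∀ i, ∀ s ∈ P i, 0 ≤ w i s) ∧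
      (∀ i, ∑ s ∈ P i, w i s = 1) ∧ ∀ i j, i ≠ j → ∀ s' ∈ P i,
        ∑ t ∈ P j, w j t * G.pay i j (G.util i) s' t ≤
          ∑ s ∈ P i, w i s * ∑ t ∈ P j, w j t * G.pay i j (G.util i) s t + ε / 4 := by
    obtain ⟨p, q, hp, hq, hp1, hq1, h1, h2⟩ := exists_approx_nash_finset (P 0) (P 1) (hPne 0)
      (hPne 1) (fun s t => G.pay 0 1 (G.util 0) s t) (fun s t => G.pay 1 0 (G.util 1) t s)
      (ε := ε / 4) (by linarith)
    refine ⟨![p, q], ?_, ?_, ?_⟩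
    · exact Fin.forall_fin_two.2 ⟨hp, hq⟩
    · exact Fin.forall_fin_two.2 ⟨hp1, hq1⟩
    · intro i j hij
      have : (i = 0 ∧ j = 1) ∨ (i = 1 ∧ j = 0) := by omega
      rcases this with ⟨rfl, rfl⟩ | ⟨rfl, rfl⟩
      · exact h1
      · exact h2
  have hne : ∀ j : Fin 2, 1 - j ≠ j := by decide
  choose τ σ hτ hσ hreach hacc using fun j : Fin 2 => exists_sampled_strategy hG hN hU (hne j)
    (hPpure j) (hw j) (hw1 j) hc hu (δ := ε / (4 * G.maxTerminalSeqs)) (by positivity) hk hk0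
  have hacc' : ∀ i j : Fin 2, i ≠ j → ∀ l s, G.IsPureStrategy i s →
      |G.pay i j (G.util l) s (σ j) - ∑ t ∈ P j, w j t * G.pay i j (G.util l) s t| ≤ ε / 4 := by
    intro i j hij l s hs
    obtain rfl : i = 1 - j := by omega
    refine (hacc j l s hs).trans_eq ?_
    field_simp
  obtain ⟨Φ, hΦiff⟩ : ∃ Φ : List A → Prop, ∀ h, Φ h ↔
      ∃ i, ∃ m ∈ range k, 0 < G.reach i (τ i m) h := ⟨_, fun _ => Iff.rfl⟩
  have hΦ : ∀ a h, a :: h ∈ G.nodes → Φ (a :: h) → Φ h := by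
    intro a h hn hah
    obtain ⟨i, m, hm, hr⟩ := (hΦiff _).1 hah
    exact (hΦiff h).2 ⟨i, m, hm, GameTree.reach_pos_of_cons (hτ i m).1 hn hr⟩
  refine ⟨G.trunk Φ hΦ hc.le, σ, ⟨isTrunk_trunk hu, fun i => trunk_isStrategy (hσ i),
    fun i s hs => ?_⟩, ?_⟩
  · obtain ⟨j, hij⟩ : ∃ j : Fin 2, i ≠ j := ⟨1 - i, (hne i).symm⟩
    obtain ⟨s', hs', hss'⟩ := exists_isStrategy_reach_eq_trunk hs
    have hreach' : ∀ h ∈ G.nodes, 0 < G.reach j (σ j) h → Φ h := fun h hh hr => by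
      obtain ⟨m, hm, hr⟩ := hreach j h hh hr
      exact (hΦiff h).2 ⟨j, m, hm, hr⟩
    have hNT : (G.trunk Φ hΦ hc.le).NoNature := fun h hh => hN h (trunk_internal.1 hh).1
    have hdev : (G.trunk Φ hΦ hc.le).value ((G.trunk Φ hΦ hc.le).upper i)
        (Function.update σ i s) = G.pay i j (G.util i) s' (σ j) := by
      have h1 : (G.trunk Φ hΦ hc.le).value ((G.trunk Φ hΦ hc.le).upper i)
          (Function.update σ i s) = (G.trunk Φ hΦ hc.le).value ((G.trunk Φ hΦ hc.le).upper i)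
          (Function.update σ i s') := by
        rw [GameTree.value_eq_pay hNT hij, GameTree.value_eq_pay hNT hij]
        simp only [Function.update_self, Function.update_of_ne hij.symm]
        refine GameTree.pay_congr_left (fun z hz => ?_) _
        rw [trunk_reach, trunk_reach]
        exact hss' z hz
      rw [h1, value_trunk (g := G.util i) hN hij]
      · simp only [Function.update_self, Function.update_of_ne hij.symm]
      · rw [Function.update_of_ne hij.symm]
        exact hσ j
      · rw [Function.update_of_ne hij.symm]
        exact hreach'
      · exact fun z hz => if_pos hz
    have hval : (G.trunk Φ hΦ hc.le).value ((G.trunk Φ hΦ hc.le).lower i) σ =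
        G.pay i j (G.util i) (σ i) (σ j) :=
      value_trunk hN hij (hσ j) hreach' fun z hz => if_pos hz
    have hle := pay_sub_pay_le (α := ε / 4) hG (hPrep i) (hPpure i) (hPpure j) (hw j) (hw1 j)
      (hnash i j hij) (hσ i) (hacc' j i hij.symm i) (hacc' i j hij i) hs'
    rw [← hdev, ← hval] at hle
    convert hle.trans_eq (by ring : ε / 4 + 3 * (ε / 4) = ε)
  · have h1 : (G.nodes.filter fun h => G.Internal h ∧ Φ h).card ≤
        ∑ i, ∑ m ∈ range k, (G.nodes.filter fun h => G.Internal h ∧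
          0 < G.reach i (τ i m) h).card := by
      refine le_trans (card_le_card (t := univ.biUnion fun i => (range k).biUnion fun m =>
        G.nodes.filter fun h => G.Internal h ∧ 0 < G.reach i (τ i m) h) fun h hh => ?_)
        (card_biUnion_le.trans (sum_le_sum fun i _ => card_biUnion_le))
      obtain ⟨hn, hint, hh⟩ := mem_filter.1 hh
      obtain ⟨i, m, hm, hr⟩ := (hΦiff h).1 hh
      exact mem_biUnion.2 ⟨i, mem_univ _, mem_biUnion.2 ⟨m, hm, mem_filter.2 ⟨hn, hint, hr⟩⟩⟩
    have h2 : ((G.nodes.filter fun h => G.Internal h ∧ Φ h).card : ℝ) ≤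
        2 * k * (√b / (√b - 1) * √(G.leaves.card)) := by
      refine (Nat.cast_le.2 h1).trans ?_
      push_cast
      refine (sum_le_sum fun i _ => sum_le_sum fun m _ =>
        GameTree.card_reached_internal_le hb hN hB hA hU (hτ i m)).trans_eq ?_
      simp only [sum_const, card_range, card_univ, Fintype.card_fin, nsmul_eq_mul]
      push_cast
      ring
    calc ((G.trunk Φ hΦ hc.le).nodes.card : ℝ)
        ≤ ((1 + b * (G.nodes.filter fun h => G.Internal h ∧ Φ h).card : ℕ) : ℝ) :=
          Nat.cast_le.2 (card_trunk_nodes_le hB)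
      _ ≤ _ := by
          push_cast
          gcongr

end TwoPlayers

end ExtensiveForm

theorem mainTheorem9 (b : ℕ) (hb : 2 ≤ b) (M ε₀ : ℝ) :
    ∃ C : ℝ, 0 < C ∧
      ∀ (A J : Type*) (G : ExtensiveForm.Game (Fin 2) A J) (d : ℕ) (ε : ℝ),
        G.PerfectRecall →
        (∀ i, ∀ z ∈ G.leaves, |G.util i z| ≤ M) →
        G.NoNature → G.UniformBranching b → G.Alternating → G.UniformDepth d →
        1 ≤ d → 0 < ε → ε ≤ ε₀ →
        ∃ (T : ExtensiveForm.Pseudogame (Fin 2) A J) (σ : Fin 2 → J → A → ℝ),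
          ExtensiveForm.IsCertificate G ε T σ ∧
          (T.nodes.card : ℝ) ≤
            C * (√(G.leaves.card : ℝ) * ((G.maxTerminalSeqs : ℝ) ^ 2 / ε ^ 2) *
              Real.log (G.leaves.card : ℝ)) := by
  have hx : 1 < √(b : ℝ) := by
    rw [Real.lt_sqrt zero_le_one]
    have : (2 : ℝ) ≤ b := by exact_mod_cast hb
    linarith
  have hx0 : 0 < √(b : ℝ) - 1 := by linarith
  have hbpos : (0 : ℝ) < b := by
    have : 0 < b := by omega
    exact_mod_cast this
  set c : ℝ := |M| + 1 with hc_def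
  have hc : 0 < c := by positivity
  set y : ℝ := √b / (√b - 1) with hy_def
  have hy : 0 < y := by positivity
  -- `384 = 8 * 4² * 3`; the terms with `ε₀` absorb the root and the rounding of `k`, since
  -- `1 ≤ 2 * ε₀² * (D² / ε²) * log N`
  refine ⟨2 * ε₀ ^ 2 + b * (2 * (384 * c ^ 2 + 2 * ε₀ ^ 2) * y), by positivity, ?_⟩
  intro A J G d ε hG hu hN hB hA hU hd hε hεε
  set N : ℝ := (G.leaves.card : ℝ) with hN_def
  set D : ℝ := (G.maxTerminalSeqs : ℝ) with hD_def
  have hD : 1 ≤ D := Nat.one_le_cast.2 (G.one_le_maxTerminalSeqs 0)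
  have hN2 : 2 ≤ N := by
    have h1 : 2 ≤ G.leaves.card := calc
      2 ≤ b ^ 1 := by rwa [pow_one]
      _ ≤ b ^ d := Nat.pow_le_pow_right (by omega) hd
      _ ≤ _ := ExtensiveForm.GameTree.pow_le_card_leaves hB hU
    rw [hN_def]
    exact_mod_cast h1
  have hlog2 : 1 / 2 ≤ Real.log 2 := by linarith [Real.log_two_gt_d9]
  have hlogN : Real.log 2 ≤ Real.log N := Real.log_le_log two_pos hN2
  have hlog4 : Real.log (4 * N) ≤ 3 * Real.log N := by
    rw [Real.log_mul (by norm_num) (by linarith), show (4 : ℝ) = 2 ^ 2 by norm_num, Real.log_pow]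
    push_cast
    linarith
  have hlog4pos : 0 < Real.log (4 * N) := Real.log_pos (by linarith)
  have hlog0 : 0 ≤ Real.log N := by linarith
  set k : ℕ := ⌈8 * c ^ 2 * Real.log (4 * N) / (ε / (4 * D)) ^ 2⌉₊ with hk_def
  have hk0 : 0 < k := Nat.ceil_pos.2 (by positivity)
  have hk : 8 * c ^ 2 * Real.log (4 * N) ≤ k * (ε / (4 * D)) ^ 2 := by
    rw [← div_le_iff₀ (by positivity)]
    exact Nat.le_ceil _
  obtain ⟨T, σ, hcert, hcard⟩ := ExtensiveForm.exists_certificate_of_sample_size hb hG hc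
    (fun l z hz => (hu l z hz).trans (by linarith [le_abs_self M])) hN hB hA hU hε hk0 hk
  refine ⟨T, σ, hcert, hcard.trans ?_⟩
  set W : ℝ := D ^ 2 / ε ^ 2 * Real.log N with hW_def
  have hW0 : 0 ≤ W := by positivity
  have hone : 1 ≤ 2 * ε₀ ^ 2 * W := by
    have h1 : 1 ≤ ε₀ ^ 2 / ε ^ 2 := by
      rw [one_le_div (by positivity)]
      exact pow_le_pow_left₀ hε.le hεε 2
    have h2 : 1 ≤ D ^ 2 := one_le_pow₀ hD
    have h3 : 1 ≤ 2 * Real.log N := by linarith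
    calc (1 : ℝ) = 1 * 1 * 1 := by norm_num
      _ ≤ (ε₀ ^ 2 / ε ^ 2) * D ^ 2 * (2 * Real.log N) := by gcongr
      _ = _ := by rw [hW_def]; ring
  have hkW : (k : ℝ) ≤ (384 * c ^ 2 + 2 * ε₀ ^ 2) * W := by
    have h1 : (k : ℝ) ≤ 8 * c ^ 2 * Real.log (4 * N) / (ε / (4 * D)) ^ 2 + 1 :=
      (Nat.ceil_lt_add_one (by positivity)).le
    have h2 : 8 * c ^ 2 * Real.log (4 * N) / (ε / (4 * D)) ^ 2 ≤ 384 * c ^ 2 * W := by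
      calc 8 * c ^ 2 * Real.log (4 * N) / (ε / (4 * D)) ^ 2
          ≤ 8 * c ^ 2 * (3 * Real.log N) / (ε / (4 * D)) ^ 2 := by gcongr
        _ = _ := by rw [hW_def]; field_simp; ring
    linarith
  have hsN : 1 ≤ √N := Real.one_le_sqrt.2 (by linarith)
  calc 1 + b * (2 * k * (y * √N))
      ≤ 2 * ε₀ ^ 2 * W * √N + b * (2 * ((384 * c ^ 2 + 2 * ε₀ ^ 2) * W) * (y * √N)) := by
        refine add_le_add ?_ (by gcongr)
        exact one_le_mul_of_one_le_of_one_le hone hsN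
    _ = _ := by rw [hW_def]; ring
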